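/- Fix $m\in\mathbb N$. **Setting.** For $n>m$, a real $m\times n$ matrix $A$ and $b\in\mathbb R^m$, let $K_n(A,b)=\{x\in\mathbb R^n_{\ge 0}: Ax=b\}$. Call $(A,b)$ nondegenerate if $A$ has rank $m$, $K_n(A,b)$ is compact, and $K_n(A,b)$ contains a point with all coordinates strictly positive. For $w\in(0,\infty)^n$ let $P_{n,w}$ be the probability measure with density $\prod_{j}w_j\,e^{-\sum_j w_jx_j}$ on $\mathbb R^n_{\ge0}$. For nondegenerate $(A,b)$ let $w=w(A,b)$ be the unique $w\in(0,\infty)^n$ for which $P_{n,w}$ has maximal entropy among all probability measures on $\mathbb R^n_{\ge 0}$ whose mean vector exists and lies in $K_n(A,b)$ (the entropy is $-\int f\log f$ if there is a density $f$ and $f\log f$ is integrable, and $-\infty$ otherwise). Put $\tilde A_{ij}=A_{ij}/w_j$, $\hat A=(\tilde A\tilde A^t)^{-1/2}\tilde A$ and $\|\hat A\|_{\max}=\max_{i,j}|\hat A_{ij}|$. For $I\subset\{1,\dots,n\}$ let $\hat A_I$ be the matrix whose columns are the columns of $\hat A$ with index in $I$. In (1) and (2), $(A^{(n)},b^{(n)})_{n>m}$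 is a sequence of nondegenerate pairs, $A^{(n)}$ being $m\times n$, and $\hat A^{(n)}$ is the matrix obtained from $(A^{(n)},b^{(n)})$. For $K,n_0\in\mathbb N$ say that *Property A holds for $K$ from $n_0$ on* if there is $C>0$ such that for every $n\ge n_0$ there are pairwise disjoint nonempty sets $I_1,\dots,I_K\subset\{1,\dots,n\}$ with $\det\big(\hat A^{(n)}_{I_l}(\hat A^{(n)}_{I_l})^t\big)\ge C$ for $l=1,\dots,K$. *Property A* means that for every $K$ there is an $n_0$ such that it holds for $K$ from $n_0$ on. **Proposition.** (1) If $\|\hat A^{(n)}\|_{\max}\to0$ as $n\to\infty$, then Property A holds. (2) Let $K\in\mathbb N$ and $n_0>m$. If for every $n\ge n_0$ every column of $A^{(n)}$ appears in $A^{(n)}$ at least $K$ times, then Property A holds for that $K$ from $n_0$ on. If the least number of times that a column of $A^{(n)}$ appears in $A^{(n)}$ tends to infinity as $n\to\infty$, then $\|\hat A^{(n)}\|_{\max}\to0$. (3) Let $P$ be a probability measure on $\mathbb R^m$ whose support $U$ is a compact subset of $\mathbb R^m_{\ge0}$, such that $0$ is not in the convex hull of $U$ and $U$ is not contained in a hyperplane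 $\{u:\langle v,u\rangle=0\}$, $v\neq0$. Let $$\mathcal B=\Big\{\int_U\frac{u}{\langle v,u\rangle}\,P(du)\;:\;v\in\mathbb R^m,\ \langle v,\cdot\rangle>0\text{ on }U\Big\}$$ and let $b\in\mathcal B$. For each $n$ let $A=A^{(n)}$ be a random $m\times n$ matrix whose columns are independent with distribution $P$. Then for every $\varepsilon>0$, with probability converging to $1$ as $n\to\infty$, the pair $(A,b)$ is nondegenerate (in particular $Ax=b$, $x\ge0$ defines a compact polytope) and $\|\hat A\|_{\max}\le\varepsilon$. -/

import Mathlib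

open MeasureTheory ProbabilityTheory Filter Topology Matrix

/-- The polytope of nonnegative solutions of `A x = b`. -/
def polytope {m n : ℕ} (A : Matrix (Fin m) (Fin n) ℝ) (b : Fin m → ℝ) : Set (Fin n → ℝ) :=
  {x | (∀ j, 0 ≤ x j) ∧ A *ᵥ x = b}

/-- The standing assumptions on a pair `(A, b)`: `A` has full rank `m`, the polytope is compact,
and it meets the open positive orthant. -/
structure IsNondegenerate {m n : ℕ} (A : Matrix (Fin m) (Fin n) ℝ) (b : Fin m → ℝ) : Prop where
  rank_eq : A.rank = m
  isCompact : IsCompact (polytope A b)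
  exists_pos : ∃ x ∈ polytope A b, ∀ j, 0 < x j

/-- The measure on `ℝⁿ` with density `(∏ wⱼ) exp(-∑ wⱼ xⱼ)` on the nonnegative orthant
(the product of the exponential laws with parameters `wⱼ`). -/
noncomputable def expProduct {n : ℕ} (w : Fin n → ℝ) : Measure (Fin n → ℝ) :=
  volume.withDensity fun x =>
    ({x : Fin n → ℝ | ∀ j, 0 ≤ x j}.indicator
      (fun x => ENNReal.ofReal ((∏ j, w j) * Real.exp (-∑ j, w j * x j)))) x

open scoped Classical in
/-- The entropy `-∫ f log f` of an absolutely continuous measure with density `f`, when `f log f` is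
integrable, and `-∞` otherwise. -/
noncomputable def entropy {n : ℕ} (Q : Measure (Fin n → ℝ)) : EReal :=
  if Q ≪ volume ∧
      Integrable (fun x => (Q.rnDeriv volume x).toReal * Real.log (Q.rnDeriv volume x).toReal) then
    ((-∫ x, (Q.rnDeriv volume x).toReal * Real.log (Q.rnDeriv volume x).toReal : ℝ) : EReal)
  else ⊥

/-- `Q` is a probability measure on the nonnegative orthant whose mean vector exists and lies in
the polytope. -/
structure HasMeanInPolytope {m n : ℕ} (A : Matrix (Fin m) (Fin n) ℝ) (b : Fin m → ℝ)
    (Q : Measure (Fin n → ℝ)) : Prop where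
  isProbabilityMeasure : IsProbabilityMeasure Q
  nonneg : ∀ᵐ x ∂Q, ∀ j, 0 ≤ x j
  integrable : ∀ j, Integrable (fun x : Fin n → ℝ => x j) Q
  mean_mem : (fun j => ∫ x, x j ∂Q) ∈ polytope A b

/-- `w` is the parameter vector of a product of exponential laws that maximizes the entropy among
all probability measures on the nonnegative orthant with mean vector in the polytope. -/
structure IsMaxEntropyWeight {m n : ℕ} (A : Matrix (Fin m) (Fin n) ℝ) (b : Fin m → ℝ)
    (w : Fin n → ℝ) : Prop where
  pos : ∀ j, 0 < w j
  hasMean : HasMeanInPolytope A b (expProduct w)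
  entropy_le : ∀ Q : Measure (Fin n → ℝ), HasMeanInPolytope A b Q →
    entropy Q ≤ entropy (expProduct w)

/-- The weight vector `w = w(A, b)`; for nondegenerate `(A, b)` it exists and is unique. -/
noncomputable def maxEntropyWeight {m n : ℕ} (A : Matrix (Fin m) (Fin n) ℝ) (b : Fin m → ℝ) :
    Fin n → ℝ :=
  Classical.epsilon (IsMaxEntropyWeight A b)

/-- `Ãᵢⱼ = Aᵢⱼ / wⱼ`. -/
noncomputable def tildeMatrix {m n : ℕ} (A : Matrix (Fin m) (Fin n) ℝ) (b : Fin m → ℝ) :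
    Matrix (Fin m) (Fin n) ℝ :=
  Matrix.of fun i j => A i j / maxEntropyWeight A b j

/-- `Â = (Ã Ãᵗ)^(-1/2) Ã`; the power of the symmetric matrix `Ã Ãᵗ` is taken by
functional calculus. -/
noncomputable def hatMatrix {m n : ℕ} (A : Matrix (Fin m) (Fin n) ℝ) (b : Fin m → ℝ) :
    Matrix (Fin m) (Fin n) ℝ :=
  cfc (fun t : ℝ => t ^ (-(1 / 2) : ℝ)) (tildeMatrix A b * (tildeMatrix A b)ᵀ) * tildeMatrix A b

/-- The largest absolute value of an entry. -/
noncomputable def maxNorm {m n : ℕ} (B : Matrix (Fin m) (Fin n) ℝ) : ℝ :=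
  ⨆ p : Fin m × Fin n, |B p.1 p.2|

/-- The matrix formed by the columns of `B` with index in `I`. -/
def columnsIn {m n : ℕ} (B : Matrix (Fin m) (Fin n) ℝ) (I : Finset (Fin n)) :
    Matrix (Fin m) I ℝ :=
  B.submatrix id (fun j : I => (j : Fin n))

/-- For one `K`, and for all `n ≥ n₀`: there are `K` pairwise disjoint nonempty sets of columns
with `det (B_I B_Iᵗ) ≥ C`, where `C > 0` does not depend on `n`. -/
def PropertyAFor {m : ℕ} (B : ∀ n, Matrix (Fin m) (Fin n) ℝ) (K n₀ : ℕ) : Prop :=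
  ∃ C : ℝ, 0 < C ∧ ∀ n, n₀ ≤ n → ∃ I : Fin K → Finset (Fin n),
    (∀ l, (I l).Nonempty) ∧ (∀ l l', l ≠ l' → Disjoint (I l) (I l')) ∧
    ∀ l, C ≤ (columnsIn (B n) (I l) * (columnsIn (B n) (I l))ᵀ).det

/-- Property A. As `K` such sets require `n ≥ K m`, the bound is for all `n` large enough
(depending on `K`). -/
def PropertyA {m : ℕ} (B : ∀ n, Matrix (Fin m) (Fin n) ℝ) : Prop :=
  ∀ K : ℕ, ∃ n₀ : ℕ, PropertyAFor B K n₀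

/-- The number of times the `j`-th column of `A` appears in `A`. -/
noncomputable def columnMultiplicity {m n : ℕ} (A : Matrix (Fin m) (Fin n) ℝ) (j : Fin n) : ℕ :=
  {k : Fin n | ∀ i, A i k = A i j}.ncard

/-- The conditions on the law of a column: the support `U` is a compact subset of the nonnegative
orthant, its convex hull does not contain `0`, and `U` lies in no hyperplane `⟨v, ·⟩ = 0`. -/
structure IsAdmissibleColumnLaw {m : ℕ} (P : Measure (Fin m → ℝ)) : Prop where
  isProbabilityMeasure : IsProbabilityMeasure P
  isCompact_support : IsCompact P.support
  support_nonneg : ∀ u ∈ P.support, ∀ i, 0 ≤ u i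
  zero_notMem : (0 : Fin m → ℝ) ∉ convexHull ℝ P.support
  not_hyperplane : ∀ v : Fin m → ℝ, v ≠ 0 → ∃ u ∈ P.support, v ⬝ᵥ u ≠ 0

/-- The set `𝓑` of vectors `∫ u / ⟨v, u⟩ P(du)` with `⟨v, ·⟩` positive on the support of `P`. -/
def goodRightHandSides {m : ℕ} (P : Measure (Fin m → ℝ)) : Set (Fin m → ℝ) :=
  {b | ∃ v : Fin m → ℝ, (∀ u ∈ P.support, 0 < v ⬝ᵥ u) ∧ ∀ i, b i = ∫ u, u i / (v ⬝ᵥ u) ∂P}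

/-! Among laws on the orthant with given positive means `x j`, the product of exponential laws has
the largest entropy, `n + ∑ log (x j)`. So the weight is `1 / x` for the `x` in the polytope that
maximizes `∏ x j`. By Lagrange multipliers this means `w = v ᵥ* A` with `1 / w` in the polytope;
such a `w` is unique by Gibbs' inequality (`maxEntropyWeight_eq`, `IsNondegenerate.exists_weight`).
Hence equal columns of `A` get equal weights and stay equal in the hat matrix, whose rows are
orthonormal.

Property A then concerns a matrix `B` with `B * Bᵀ = 1`: the rank-one matrices of its columns sum to
the identity. If the entries are small, a greedy splitting into `K` groups makes every group sum
close to `K⁻¹ • 1` (`exists_balanced_coloring`). If columns repeat, splitting each class of equal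
columns into `K` comparable parts makes every group sum at least `(2 * K)⁻¹ • 1`. An entry repeated
`R` times in a row of length one is at most `R ^ (-1/2)`.

For random columns `u j`, the law of large numbers makes `n⁻¹ ∑ u j / ⟨v, u j⟩` close to `b`. A
strictly concave logarithmic potential then has a critical point `v'` near `v`, where equality is
exact, and `w = n • (v' ᵥ* A)` (`exists_sum_column_div_eq`). Since `w` has order `n`, the columns of
the tilde matrix have size `O(1/n)` and its Gram matrix is at least a constant times `n⁻¹`, so the
hat matrix has entries `O(n ^ (-1/2))`. -/

/-! ### Exponential laws on the line -/

/-- The exponential density with parameter `c`. -/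
noncomputable def expDensity (c : ℝ) : ℝ → ℝ :=
  (Set.Ici 0).indicator fun t => c * Real.exp (-(c * t))

lemma expDensity_nonneg {c : ℝ} (hc : 0 < c) (t : ℝ) : 0 ≤ expDensity c t :=
  Set.indicator_nonneg (fun _ _ => by positivity) t

lemma measurable_expDensity (c : ℝ) : Measurable (expDensity c) :=
  Measurable.indicator (by fun_prop) measurableSet_Ici

/-- A non-integrable function has integral zero by convention, while the Gamma integral is positive.
-/
lemma integrableOn_rpow_mul_exp {a c : ℝ} (ha : 0 < a) (hc : 0 < c) :
    IntegrableOn (fun t : ℝ => t ^ (a - 1) * Real.exp (-(c * t))) (Set.Ioi 0) := by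
  refine not_imp_comm.1 integral_undef ?_
  rw [Real.integral_rpow_mul_exp_neg_mul_Ioi ha hc]
  have := Real.Gamma_pos_of_pos ha
  positivity

lemma integrable_expDensity {c : ℝ} (hc : 0 < c) : Integrable (expDensity c) := by
  rw [expDensity, integrable_indicator_iff measurableSet_Ici, integrableOn_Ici_iff_integrableOn_Ioi]
  simpa [IntegrableOn] using (integrableOn_rpow_mul_exp one_pos hc).const_mul c

lemma integral_expDensity {c : ℝ} (hc : 0 < c) : ∫ t, expDensity c t = 1 := by
  have h := Real.integral_rpow_mul_exp_neg_mul_Ioi one_pos hc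
  simp only [sub_self, Real.rpow_zero, one_mul, Real.rpow_one, Real.Gamma_one, mul_one] at h
  rw [expDensity, integral_indicator measurableSet_Ici, integral_Ici_eq_integral_Ioi,
    integral_const_mul, h]
  field_simp

lemma id_mul_expDensity (c : ℝ) :
    (fun t => t * expDensity c t) =
      (Set.Ici 0).indicator fun t => c * (t ^ ((2 : ℝ) - 1) * Real.exp (-(c * t))) := by
  ext t
  by_cases ht : t ∈ Set.Ici (0 : ℝ)
  · simp only [expDensity, Set.indicator_of_mem ht]
    norm_num
    ring
  · simp [expDensity, Set.indicator_of_notMem ht]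

lemma integrable_id_mul_expDensity {c : ℝ} (hc : 0 < c) :
    Integrable (fun t => t * expDensity c t) := by
  rw [id_mul_expDensity, integrable_indicator_iff measurableSet_Ici,
    integrableOn_Ici_iff_integrableOn_Ioi]
  exact (integrableOn_rpow_mul_exp two_pos hc).const_mul c

lemma integral_id_mul_expDensity {c : ℝ} (hc : 0 < c) :
    ∫ t, t * expDensity c t = 1 / c := by
  have h := Real.integral_rpow_mul_exp_neg_mul_Ioi two_pos hc
  rw [id_mul_expDensity, integral_indicator measurableSet_Ici, integral_Ici_eq_integral_Ioi,
    integral_const_mul, h, Real.Gamma_two]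
  norm_num
  field_simp

/-! ### Products of exponential laws and Gibbs' inequality -/

/-- The density of the product of exponential laws. -/
noncomputable def expProductDensity {n : ℕ} (w : Fin n → ℝ) (x : Fin n → ℝ) : ℝ :=
  ∏ j, expDensity (w j) (x j)

section expProduct

variable {n : ℕ} {w : Fin n → ℝ}

lemma expProductDensity_of_nonneg {x : Fin n → ℝ} (hx : ∀ j, 0 ≤ x j) :
    expProductDensity w x = (∏ j, w j) * Real.exp (-∑ j, w j * x j) := by
  rw [← Finset.sum_neg_distrib, Real.exp_sum, ← Finset.prod_mul_distrib]
  exact Finset.prod_congr rfl fun j _ => Set.indicator_of_mem (hx j) _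

lemma expProductDensity_of_not_nonneg {x : Fin n → ℝ} (hx : ¬ ∀ j, 0 ≤ x j) :
    expProductDensity w x = 0 := by
  push Not at hx
  obtain ⟨j, hj⟩ := hx
  exact Finset.prod_eq_zero (Finset.mem_univ j) (Set.indicator_of_notMem (by simpa using hj) _)

lemma expProductDensity_nonneg (hw : ∀ j, 0 < w j) (x : Fin n → ℝ) : 0 ≤ expProductDensity w x :=
  Finset.prod_nonneg fun j _ => expDensity_nonneg (hw j) _

lemma measurable_expProductDensity (w : Fin n → ℝ) : Measurable (expProductDensity w) :=
  Finset.measurable_prod _ fun j _ => (measurable_expDensity (w j)).comp (measurable_pi_apply j)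

lemma expProduct_eq_withDensity (w : Fin n → ℝ) :
    expProduct w = volume.withDensity fun x => ENNReal.ofReal (expProductDensity w x) := by
  unfold expProduct
  congr 1
  ext x
  by_cases hx : ∀ j, 0 ≤ x j
  · rw [Set.indicator_of_mem (by exact hx), expProductDensity_of_nonneg hx]
  · rw [Set.indicator_of_notMem (by exact hx), expProductDensity_of_not_nonneg hx,
      ENNReal.ofReal_zero]

lemma integrable_expProduct_iff (hw : ∀ j, 0 < w j) {g : (Fin n → ℝ) → ℝ} :
    Integrable g (expProduct w) ↔ Integrable fun x => expProductDensity w x * g x := by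
  rw [expProduct_eq_withDensity, integrable_withDensity_iff_integrable_smul'
    (measurable_expProductDensity w).ennreal_ofReal (by simp)]
  simp [ENNReal.toReal_ofReal (expProductDensity_nonneg hw _)]

lemma integral_expProduct (hw : ∀ j, 0 < w j) (g : (Fin n → ℝ) → ℝ) :
    ∫ x, g x ∂(expProduct w) = ∫ x, expProductDensity w x * g x := by
  rw [expProduct_eq_withDensity, integral_withDensity_eq_integral_toReal_smul
    (measurable_expProductDensity w).ennreal_ofReal (by simp)]
  simp [ENNReal.toReal_ofReal (expProductDensity_nonneg hw _)]

lemma integrable_expProductDensity (hw : ∀ j, 0 < w j) : Integrable (expProductDensity w) :=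
  Integrable.fintype_prod fun j => integrable_expDensity (hw j)

lemma integral_expProductDensity (hw : ∀ j, 0 < w j) : ∫ x, expProductDensity w x = 1 := by
  unfold expProductDensity
  rw [integral_fintype_prod_volume_eq_prod]
  exact Finset.prod_eq_one fun j _ => integral_expDensity (hw j)

/-- The extra coordinate is absorbed into one factor, so the integrand is again a product over
coordinates. -/
lemma expProductDensity_mul_coord (k : Fin n) :
    (fun x => expProductDensity w x * x k) =
      fun x => ∏ j, (if j = k then fun t => t * expDensity (w j) t else expDensity (w j)) (x j) := by
  ext x
  have h : ∏ j ∈ Finset.univ.erase k, expDensity (w j) (x j) = ∏ j ∈ Finset.univ.erase k,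
      (if j = k then fun t => t * expDensity (w j) t else expDensity (w j)) (x j) :=
    Finset.prod_congr rfl fun j hj => by rw [if_neg (Finset.ne_of_mem_erase hj)]
  rw [expProductDensity, ← Finset.mul_prod_erase _ _ (Finset.mem_univ k),
    ← Finset.mul_prod_erase _ _ (Finset.mem_univ k), if_pos rfl, h]
  ring

lemma isProbabilityMeasure_expProduct (hw : ∀ j, 0 < w j) :
    IsProbabilityMeasure (expProduct w) := by
  refine ⟨?_⟩
  rw [expProduct_eq_withDensity, withDensity_apply _ MeasurableSet.univ, Measure.restrict_univ,
    ← ofReal_integral_eq_lintegral_ofReal (integrable_expProductDensity hw)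
      (ae_of_all _ (expProductDensity_nonneg hw)), integral_expProductDensity hw, ENNReal.ofReal_one]

lemma ae_nonneg_expProduct (w : Fin n → ℝ) : ∀ᵐ x ∂(expProduct w), ∀ j, 0 ≤ x j := by
  rw [expProduct_eq_withDensity,
    ae_withDensity_iff (measurable_expProductDensity w).ennreal_ofReal]
  refine ae_of_all _ fun x hx => ?_
  by_contra h
  simp [expProductDensity_of_not_nonneg h] at hx

lemma integrable_coord_expProduct (hw : ∀ j, 0 < w j) (k : Fin n) :
    Integrable (fun x => x k) (expProduct w) := by
  rw [integrable_expProduct_iff hw, expProductDensity_mul_coord]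
  refine Integrable.fintype_prod fun j => ?_
  split_ifs
  exacts [integrable_id_mul_expDensity (hw j), integrable_expDensity (hw j)]

lemma integral_coord_expProduct (hw : ∀ j, 0 < w j) (k : Fin n) :
    ∫ x, x k ∂(expProduct w) = 1 / w k := by
  rw [integral_expProduct hw, expProductDensity_mul_coord, integral_fintype_prod_volume_eq_prod,
    Finset.prod_eq_single k]
  · simpa using integral_id_mul_expDensity (hw k)
  · intro j _ hj
    simpa [hj] using integral_expDensity (hw j)
  · simp

/-- The logarithm of the density of `expProduct w` on the orthant. -/
noncomputable def logExpDensity (w x : Fin n → ℝ) : ℝ := ∑ j, Real.log (w j) - ∑ j, w j * x j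

lemma integrable_logExpDensity {Q : Measure (Fin n → ℝ)} [IsProbabilityMeasure Q]
    (hQ : ∀ j, Integrable (fun x : Fin n → ℝ => x j) Q) : Integrable (logExpDensity w) Q :=
  (integrable_const _).sub (integrable_finsetSum _ fun j _ => (hQ j).const_mul _)

lemma integral_logExpDensity {Q : Measure (Fin n → ℝ)} [IsProbabilityMeasure Q]
    (hQ : ∀ j, Integrable (fun x : Fin n → ℝ => x j) Q) :
    ∫ x, logExpDensity w x ∂Q = ∑ j, Real.log (w j) - ∑ j, w j * ∫ x, x j ∂Q := by
  unfold logExpDensity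
  rw [integral_sub (integrable_const _) (integrable_finsetSum _ fun j _ => (hQ j).const_mul _),
    integral_finsetSum _ fun j _ => (hQ j).const_mul _]
  simp [integral_const_mul]

lemma log_expProductDensity (hw : ∀ j, 0 < w j) {x : Fin n → ℝ} (hx : ∀ j, 0 ≤ x j) :
    Real.log (expProductDensity w x) = logExpDensity w x := by
  rw [expProductDensity_of_nonneg hx, Real.log_mul (Finset.prod_pos fun j _ => hw j).ne'
    (Real.exp_pos _).ne', Real.log_exp, Real.log_prod fun j _ => (hw j).ne', logExpDensity]
  ring

lemma expProductDensity_mul_log (hw : ∀ j, 0 < w j) (x : Fin n → ℝ) :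
    expProductDensity w x * Real.log (expProductDensity w x) =
      expProductDensity w x * logExpDensity w x := by
  by_cases hx : ∀ j, 0 ≤ x j
  · rw [log_expProductDensity hw hx]
  · rw [expProductDensity_of_not_nonneg hx, zero_mul, zero_mul]

lemma entropy_expProduct (hw : ∀ j, 0 < w j) :
    entropy (expProduct w) = ((n - ∑ j, Real.log (w j) : ℝ) : EReal) := by
  have := isProbabilityMeasure_expProduct hw
  have hac : expProduct w ≪ volume := by
    rw [expProduct_eq_withDensity]
    exact withDensity_absolutelyContinuous _ _
  have hae : (fun x => ((expProduct w).rnDeriv volume x).toReal *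
      Real.log ((expProduct w).rnDeriv volume x).toReal) =ᵐ[volume]
      fun x => expProductDensity w x * logExpDensity w x := by
    have h := Measure.rnDeriv_withDensity (volume : Measure (Fin n → ℝ))
      (measurable_expProductDensity w).ennreal_ofReal
    rw [← expProduct_eq_withDensity] at h
    filter_upwards [h] with x hx
    rw [hx, ENNReal.toReal_ofReal (expProductDensity_nonneg hw x), expProductDensity_mul_log hw]
  have hint : Integrable fun x => expProductDensity w x * logExpDensity w x :=
    (integrable_expProduct_iff hw).1 (integrable_logExpDensity (integrable_coord_expProduct hw))
  rw [entropy, if_pos ⟨hac, hint.congr hae.symm⟩, integral_congr_ae hae, ← integral_expProduct hw,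
    integral_logExpDensity (integrable_coord_expProduct hw)]
  simp [integral_coord_expProduct hw, fun j => mul_inv_cancel₀ (hw j).ne']

/-- The integrand of Gibbs' inequality, from `log s ≤ s - 1` at `s = f / a`. -/
lemma sub_le_mul_log_sub_mul_log {a f : ℝ} (ha : 0 ≤ a) (hf : 0 < f) :
    a - f ≤ a * Real.log a - a * Real.log f := by
  rcases ha.eq_or_lt with rfl | ha
  · simp [hf.le]
  · have h := Real.log_le_sub_one_of_pos (div_pos hf ha)
    rw [Real.log_div hf.ne' ha.ne'] at h
    have h2 := mul_le_mul_of_nonneg_left h ha.le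
    have h3 : a * (f / a - 1) = f - a := by field_simp
    linarith

/-- Gibbs' inequality: the entropy is at most the cross entropy with `expProduct w`. -/
lemma entropy_le_crossEntropy (hw : ∀ j, 0 < w j) {Q : Measure (Fin n → ℝ)}
    [IsProbabilityMeasure Q] (hnn : ∀ᵐ x ∂Q, ∀ j, 0 ≤ x j)
    (hQ : ∀ j, Integrable (fun x : Fin n → ℝ => x j) Q) :
    entropy Q ≤ ((∑ j, w j * ∫ x, x j ∂Q - ∑ j, Real.log (w j) : ℝ) : EReal) := by
  unfold entropy
  split_ifs with h
  swap
  · exact bot_le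
  obtain ⟨hac, hint⟩ := h
  rw [EReal.coe_le_coe_iff]
  set q : (Fin n → ℝ) → ℝ := fun x => (Q.rnDeriv volume x).toReal with hq
  have hqint : Integrable q := Measure.integrable_toReal_rnDeriv
  have hq1 : ∫ x, q x = 1 := by
    rw [hq, Measure.integral_toReal_rnDeriv hac]
    simp
  have hqL : Integrable fun x => q x * logExpDensity w x :=
    (integrable_toReal_rnDeriv_mul_iff hac).2 (integrable_logExpDensity hQ)
  have hqL1 : ∫ x, q x * logExpDensity w x = ∫ x, logExpDensity w x ∂Q :=
    integral_toReal_rnDeriv_mul hac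
  -- `logExpDensity` is the logarithm of the density only on the orthant, so `q` has to vanish
  -- elsewhere.
  have hsupp : ∀ᵐ x, ¬ (∀ j, 0 ≤ x j) → q x = 0 := by
    rw [← Measure.withDensity_rnDeriv_eq Q volume hac,
      ae_withDensity_iff (Measure.measurable_rnDeriv Q volume)] at hnn
    filter_upwards [hnn] with x hx hneg
    by_contra h0
    refine hneg (hx fun h => h0 ?_)
    simp [hq, h]
  have hle : ∀ᵐ x, q x - expProductDensity w x ≤
      q x * Real.log (q x) - q x * logExpDensity w x := by
    filter_upwards [hsupp] with x hx
    by_cases hp : ∀ j, 0 ≤ x j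
    · rw [← log_expProductDensity hw hp]
      refine sub_le_mul_log_sub_mul_log ENNReal.toReal_nonneg ?_
      rw [expProductDensity_of_nonneg hp]
      exact mul_pos (Finset.prod_pos fun j _ => hw j) (Real.exp_pos _)
    · rw [hx hp, expProductDensity_of_not_nonneg hp]
      simp
  -- Both densities have mass one, so the left side integrates to zero.
  have := integral_mono_ae (hqint.sub (integrable_expProductDensity hw)) (hint.sub hqL) hle
  simp only [Pi.sub_apply] at this
  rw [integral_sub hqint (integrable_expProductDensity hw), integral_sub hint hqL, hq1,
    integral_expProductDensity hw, hqL1, integral_logExpDensity hQ] at this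
  linarith

end expProduct

/-! ### Characterization of the maximum entropy weight -/

section weight

variable {m n : ℕ} {A : Matrix (Fin m) (Fin n) ℝ} {b : Fin m → ℝ} {w : Fin n → ℝ}

lemma vecMul_dotProduct_of_mem_polytope (v : Fin m → ℝ) {y : Fin n → ℝ} (hy : y ∈ polytope A b) :
    ∑ j, (v ᵥ* A) j * y j = v ⬝ᵥ b := by
  rw [← hy.2, dotProduct_mulVec]
  rfl

lemma vecMul_dotProduct_eq_card {v : Fin m → ℝ} (hw : ∀ j, 0 < w j) (hv : v ᵥ* A = w)
    (hx : (fun j => 1 / w j) ∈ polytope A b) : v ⬝ᵥ b = n := by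
  rw [← vecMul_dotProduct_of_mem_polytope v hx, hv]
  simp [fun j => mul_inv_cancel₀ (hw j).ne']

lemma hasMeanInPolytope_expProduct (hw : ∀ j, 0 < w j)
    (hx : (fun j => 1 / w j) ∈ polytope A b) : HasMeanInPolytope A b (expProduct w) where
  isProbabilityMeasure := isProbabilityMeasure_expProduct hw
  nonneg := ae_nonneg_expProduct w
  integrable := integrable_coord_expProduct hw
  mean_mem := by simpa only [integral_coord_expProduct hw] using hx

/-- For weights in the row space, the cross entropy depends on a competitor only through `v ⬝ᵥ b`,
so Gibbs' bound is the same for all competitors and is attained by `expProduct w`. -/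
lemma isMaxEntropyWeight_of_vecMul_eq {v : Fin m → ℝ} (hw : ∀ j, 0 < w j) (hv : v ᵥ* A = w)
    (hx : (fun j => 1 / w j) ∈ polytope A b) : IsMaxEntropyWeight A b w where
  pos := hw
  hasMean := hasMeanInPolytope_expProduct hw hx
  entropy_le Q hQ := by
    have := hQ.isProbabilityMeasure
    refine (entropy_le_crossEntropy hw hQ.nonneg hQ.integrable).trans_eq ?_
    have h := vecMul_dotProduct_of_mem_polytope v hQ.mean_mem
    rw [hv, vecMul_dotProduct_eq_card hw hv hx] at h
    rw [h, entropy_expProduct hw]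

/-- A weight vector in the row space of `A` with reciprocal in the polytope is the maximum entropy
weight. -/
lemma maxEntropyWeight_eq {v : Fin m → ℝ} (hw : ∀ j, 0 < w j) (hv : v ᵥ* A = w)
    (hx : (fun j => 1 / w j) ∈ polytope A b) : maxEntropyWeight A b = w := by
  have h : IsMaxEntropyWeight A b (maxEntropyWeight A b) :=
    Classical.epsilon_spec ⟨w, isMaxEntropyWeight_of_vecMul_eq hw hv hx⟩
  set u := maxEntropyWeight A b
  have hent := h.entropy_le _ (hasMeanInPolytope_expProduct hw hx)
  rw [entropy_expProduct hw, entropy_expProduct h.pos, EReal.coe_le_coe_iff] at hent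
  have hmem := h.hasMean.mean_mem
  simp only [integral_coord_expProduct h.pos] at hmem
  have hsum := vecMul_dotProduct_of_mem_polytope v hmem
  rw [vecMul_dotProduct_eq_card hw hv hx, hv] at hsum
  have hpos : ∀ j, 0 < w j * (1 / u j) := fun j => mul_pos (hw j) (one_div_pos.2 (h.pos j))
  have hlog : ∀ j, Real.log (w j * (1 / u j)) = Real.log (w j) - Real.log (u j) := fun j => by
    rw [mul_one_div, Real.log_div (hw j).ne' (h.pos j).ne']
  by_contra hne
  obtain ⟨k, hk⟩ := Function.ne_iff.1 hne
  -- The right side is zero because `∑ w j / u j = n`, whereas maximality of `u` makes the left side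
  -- nonnegative.
  have hlt : ∑ j, Real.log (w j * (1 / u j)) < ∑ j, (w j * (1 / u j) - 1) := by
    refine Finset.sum_lt_sum (fun j _ => Real.log_le_sub_one_of_pos (hpos j))
      ⟨k, Finset.mem_univ k, Real.log_lt_sub_one_of_pos (hpos k) fun h1 => hk ?_⟩
    have := (h.pos k).ne'
    field_simp at h1
    exact h1.symm
  simp only [hlog, Finset.sum_sub_distrib, hsum] at hlt
  simp at hlt
  linarith

/-- Lagrange multipliers: a functional vanishing on the common kernel of the rows is a combination
of them. -/
lemma exists_vecMul_eq_of_ker (h : ∀ d, A *ᵥ d = 0 → w ⬝ᵥ d = 0) : ∃ v, v ᵥ* A = w := by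
  classical
  let L : Fin m → (Fin n → ℝ) →ₗ[ℝ] ℝ := fun i => dotProductBilin ℝ ℝ (A i)
  have hmem : (dotProductBilin ℝ ℝ w : (Fin n → ℝ) →ₗ[ℝ] ℝ) ∈ Submodule.span ℝ (Set.range L) := by
    refine mem_span_of_iInf_ker_le_ker fun d hd => ?_
    rw [Submodule.mem_iInf] at hd
    exact h d (funext fun i => hd i)
  obtain ⟨v, hv⟩ := (Submodule.mem_span_range_iff_exists_fun ℝ).1 hmem
  refine ⟨v, funext fun j => ?_⟩
  have := LinearMap.congr_fun hv (Pi.single j 1)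
  simpa [L, vecMul, dotProduct, Pi.single_apply] using this

/-- For a nondegenerate pair the maximum entropy weight lies in the row space of `A` and its
reciprocal lies in the polytope. -/
lemma IsNondegenerate.exists_weight (h : IsNondegenerate A b) :
    ∃ v : Fin m → ℝ, v ᵥ* A = maxEntropyWeight A b ∧ (∀ j, 0 < maxEntropyWeight A b j) ∧
      (fun j => 1 / maxEntropyWeight A b j) ∈ polytope A b := by
  obtain ⟨y, hy, hypos⟩ := h.exists_pos
  -- The product, unlike the sum of logarithms, is continuous up to the boundary of the orthant; its
  -- maximizer is positive because some point of the polytope is.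
  obtain ⟨x, hx, hmax⟩ := h.isCompact.exists_isMaxOn ⟨y, hy⟩
    (f := fun x : Fin n → ℝ => ∏ j, x j) (by fun_prop)
  have hprod : 0 < ∏ j, x j := (Finset.prod_pos fun j _ => hypos j).trans_le (hmax hy)
  have hxpos : ∀ j, 0 < x j := fun j =>
    (hx.1 j).lt_of_ne fun h0 => hprod.ne' (Finset.prod_eq_zero (Finset.mem_univ j) h0.symm)
  have hcrit : ∀ d, A *ᵥ d = 0 → (fun j => 1 / x j) ⬝ᵥ d = 0 := by
    intro d hd
    have hder : HasDerivAt (fun t : ℝ => ∑ j, Real.log (x j + t * d j))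
        (∑ j, d j / (x j + 0 * d j)) 0 := by
      refine HasDerivAt.fun_sum fun j _ => HasDerivAt.log ?_ (by simpa using (hxpos j).ne')
      simpa using ((hasDerivAt_id (0 : ℝ)).mul_const (d j)).const_add (x j)
    have hloc : IsLocalMax (fun t : ℝ => ∑ j, Real.log (x j + t * d j)) 0 := by
      have hev : ∀ᶠ t : ℝ in 𝓝 0, ∀ j, 0 < x j + t * d j := by
        refine eventually_all.2 fun j => ?_
        have : ContinuousAt (fun t : ℝ => x j + t * d j) 0 := by fun_prop
        exact this.eventually_const_lt (by simpa using hxpos j)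
      filter_upwards [hev] with t ht
      have hmem : (fun j => x j + t * d j) ∈ polytope A b := by
        refine ⟨fun j => (ht j).le, ?_⟩
        have : (fun j => x j + t * d j) = x + t • d := rfl
        rw [this, mulVec_add, mulVec_smul, hd, hx.2, smul_zero, add_zero]
      simp only [zero_mul, add_zero]
      rw [← Real.log_prod fun j _ => (ht j).ne', ← Real.log_prod fun j _ => (hxpos j).ne']
      exact Real.log_le_log (Finset.prod_pos fun j _ => ht j) (hmax hmem)
    have := hloc.hasDerivAt_eq_zero hder
    simpa [dotProduct, div_eq_inv_mul] using this
  obtain ⟨v, hv⟩ := exists_vecMul_eq_of_ker hcrit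
  have hpos : ∀ j, 0 < 1 / x j := fun j => one_div_pos.2 (hxpos j)
  have hinv : (fun j => 1 / (1 / x j)) ∈ polytope A b := by simpa using hx
  rw [maxEntropyWeight_eq hpos hv hinv]
  exact ⟨v, hv, hpos, hinv⟩

end weight

/-! ### The hat matrix -/

section hat

variable {m n : ℕ} {A : Matrix (Fin m) (Fin n) ℝ} {b : Fin m → ℝ}

/-- The inverse square root in the definition of `hatMatrix`, as a symmetric matrix. -/
lemma exists_hatMatrix_eq_mul (hS : (tildeMatrix A b * (tildeMatrix A b)ᵀ).PosDef) :
    ∃ c : Matrix (Fin m) (Fin m) ℝ, cᵀ = c ∧ hatMatrix A b = c * tildeMatrix A b ∧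
      c * (tildeMatrix A b * (tildeMatrix A b)ᵀ) * c = 1 := by
  set S := tildeMatrix A b * (tildeMatrix A b)ᵀ with hSdef
  have hsa : IsSelfAdjoint S := hS.isHermitian
  have hspec : ∀ t ∈ spectrum ℝ S, 0 < t := by
    intro t ht
    rw [hS.isHermitian.spectrum_real_eq_range_eigenvalues] at ht
    obtain ⟨i, rfl⟩ := ht
    exact hS.eigenvalues_pos i
  have hcont : ContinuousOn (fun t : ℝ => t ^ (-(1 / 2) : ℝ)) (spectrum ℝ S) := fun t ht =>
    (Real.continuousAt_rpow_const _ _ (Or.inl (hspec t ht).ne')).continuousWithinAt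
  refine ⟨cfc (fun t : ℝ => t ^ (-(1 / 2) : ℝ)) S, ?_, rfl, ?_⟩
  · have h : IsSelfAdjoint (cfc (fun t : ℝ => t ^ (-(1 / 2) : ℝ)) S) := cfc_predicate _ _
    simpa [IsSelfAdjoint, star_eq_conjTranspose, conjTranspose_eq_transpose_of_trivial] using h
  -- With the middle `S` written as a functional calculus, the product becomes that of `t ^ (-1/2) *
  -- t * t ^ (-1/2)`, which is one on the positive spectrum.
  · nth_rewrite 2 [← cfc_id' ℝ S]
    rw [← cfc_mul _ _ S hcont, ← cfc_mul (fun t : ℝ => t ^ (-(1 / 2) : ℝ) * t) _ S (hcont.mul continuousOn_id) hcont,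
      ← cfc_const_one ℝ S]
    refine cfc_congr fun t ht => ?_
    have h0 := hspec t ht
    calc t ^ (-(1 / 2) : ℝ) * t * t ^ (-(1 / 2) : ℝ)
        = t ^ (-(1 / 2) : ℝ) * t ^ (-(1 / 2) : ℝ) * t := by ring
      _ = 1 := by
        rw [← Real.rpow_add h0]
        norm_num
        rw [Real.rpow_neg_one, inv_mul_cancel₀ h0.ne']

lemma hatMatrix_mul_transpose (hS : (tildeMatrix A b * (tildeMatrix A b)ᵀ).PosDef) :
    hatMatrix A b * (hatMatrix A b)ᵀ = 1 := by
  obtain ⟨c, hc, hhat, h1⟩ := exists_hatMatrix_eq_mul hS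
  rw [hhat, transpose_mul, hc, ← h1]
  simp only [Matrix.mul_assoc]

lemma vecMul_tildeMatrix (z : Fin m → ℝ) (j : Fin n) :
    (z ᵥ* tildeMatrix A b) j = (z ᵥ* A) j / maxEntropyWeight A b j := by
  simp [vecMul, dotProduct, tildeMatrix, Finset.sum_div, mul_div_assoc]

lemma posDef_mul_transpose {B : Matrix (Fin m) (Fin n) ℝ} (hB : ∀ z, z ᵥ* B = 0 → z = 0) :
    (B * Bᵀ).PosDef := by
  have h := Matrix.PosDef.mul_conjTranspose_self B (fun y z hyz => by
    have := hB (y - z) (by rw [sub_vecMul]; exact sub_eq_zero.2 hyz)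
    exact sub_eq_zero.1 this)
  rwa [conjTranspose_eq_transpose_of_trivial] at h

lemma eq_zero_of_vecMul_eq_zero (hA : A.rank = m) {z : Fin m → ℝ} (hz : z ᵥ* A = 0) : z = 0 := by
  have hli : LinearIndependent ℝ A.row := by
    rw [linearIndependent_iff_card_eq_finrank_span, Set.finrank, ← rank_eq_finrank_span_row, hA,
      Fintype.card_fin]
  exact vecMul_injective_iff.2 hli (by simpa using hz)

lemma rank_eq_of_vecMul (hA : ∀ z, z ᵥ* A = 0 → z = 0) : A.rank = m := by
  have hli : LinearIndependent ℝ A.row := vecMul_injective_iff.1 fun y z hyz =>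
    sub_eq_zero.1 (hA (y - z) (by rw [sub_vecMul]; exact sub_eq_zero.2 hyz))
  simpa using hli.rank_matrix

lemma IsNondegenerate.posDef (h : IsNondegenerate A b) :
    (tildeMatrix A b * (tildeMatrix A b)ᵀ).PosDef := by
  obtain ⟨v, -, hw, -⟩ := h.exists_weight
  refine posDef_mul_transpose fun z hz => eq_zero_of_vecMul_eq_zero h.rank_eq (funext fun j => ?_)
  have := congrFun hz j
  rw [vecMul_tildeMatrix, Pi.zero_apply, div_eq_zero_iff] at this
  exact this.resolve_right (hw j).ne'

lemma IsNondegenerate.hatMatrix_mul_transpose (h : IsNondegenerate A b) :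
    hatMatrix A b * (hatMatrix A b)ᵀ = 1 :=
  _root_.hatMatrix_mul_transpose h.posDef

/-- Equal columns of `A` give equal columns of the hat matrix. -/
lemma IsNondegenerate.hatMatrix_column_eq (h : IsNondegenerate A b) {j k : Fin n}
    (hjk : ∀ i, A i k = A i j) (i : Fin m) : hatMatrix A b i k = hatMatrix A b i j := by
  obtain ⟨v, hv, -, -⟩ := h.exists_weight
  -- As `w = v ᵥ* A`, a weight depends only on its column.
  have hw : maxEntropyWeight A b k = maxEntropyWeight A b j := by
    rw [← hv]
    simp [vecMul, dotProduct, hjk]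
  simp [hatMatrix, Matrix.mul_apply, tildeMatrix, hw, hjk]

/-- A lower bound for the Gram matrix of the columns `Aⱼ / wⱼ` bounds the columns of the hat
matrix. -/
lemma sq_hatMatrix_le {μ : ℝ} (hμ : 0 < μ)
    (hS : ∀ z, μ * (z ⬝ᵥ z) ≤ z ⬝ᵥ ((tildeMatrix A b * (tildeMatrix A b)ᵀ) *ᵥ z))
    (i : Fin m) (j : Fin n) :
    (hatMatrix A b i j) ^ 2 ≤ (∑ k, tildeMatrix A b k j ^ 2) / μ := by
  have hpd : (tildeMatrix A b * (tildeMatrix A b)ᵀ).PosDef := by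
    refine posDef_mul_transpose fun z hz => ?_
    have h := hS z
    rw [← mulVec_mulVec, mulVec_transpose, hz, mulVec_zero, dotProduct_zero] at h
    have h0 : 0 ≤ z ⬝ᵥ z := Finset.sum_nonneg fun i _ => mul_self_nonneg _
    exact dotProduct_self_eq_zero.1 (le_antisymm (by nlinarith) h0)
  obtain ⟨c, hc, hhat, h1⟩ := exists_hatMatrix_eq_mul hpd
  generalize tildeMatrix A b * (tildeMatrix A b)ᵀ = S at *
  set a : Fin m → ℝ := fun k => tildeMatrix A b k j with ha
  have hz : ∀ i, hatMatrix A b i j = (c *ᵥ a) i := fun i => by rw [hhat]; rfl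
  -- `z` is the column of the hat matrix. For `y = c *ᵥ z`, the identity `c * S * c = 1` gives `⟨y,
  -- S y⟩ = ⟨z, z⟩ = ⟨y, a⟩`. Thus `μ |y|² ≤ |z|²`, and Cauchy–Schwarz yields `μ |z|² ≤ |a|²`.
  set z := c *ᵥ a with hzdef
  set y := c *ᵥ z with hy
  have hyy := hS y
  have hyS : y ⬝ᵥ (S *ᵥ y) = z ⬝ᵥ z := by
    have : y = z ᵥ* c := by rw [hy, ← vecMul_transpose, hc]
    nth_rewrite 1 [this]
    rw [← dotProduct_mulVec, hy, mulVec_mulVec, mulVec_mulVec, h1, one_mulVec]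
  have hya : y ⬝ᵥ a = z ⬝ᵥ z := by
    have : y = z ᵥ* c := by rw [hy, ← vecMul_transpose, hc]
    rw [this, ← dotProduct_mulVec]
  rw [hyS] at hyy
  have hcs : (y ⬝ᵥ a) ^ 2 ≤ (y ⬝ᵥ y) * (a ⬝ᵥ a) := by
    simpa [dotProduct, sq] using Finset.sum_mul_sq_le_sq_mul_sq Finset.univ y a
  rw [hya] at hcs
  have hzz : 0 ≤ z ⬝ᵥ z := Finset.sum_nonneg fun i _ => mul_self_nonneg _
  have haa : 0 ≤ a ⬝ᵥ a := Finset.sum_nonneg fun i _ => mul_self_nonneg _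
  have haz : μ * (z ⬝ᵥ z) ≤ a ⬝ᵥ a := by
    rcases hzz.eq_or_lt with h | h
    · rw [← h, mul_zero]
      exact haa
    · have : (z ⬝ᵥ z) * (μ * (z ⬝ᵥ z)) ≤ (z ⬝ᵥ z) * (a ⬝ᵥ a) := by nlinarith
      exact le_of_mul_le_mul_left this h
  rw [le_div_iff₀ hμ, hz]
  have hi : z i ^ 2 ≤ z ⬝ᵥ z := by
    rw [sq]
    exact Finset.single_le_sum (f := fun k => z k * z k) (fun k _ => mul_self_nonneg _)
      (Finset.mem_univ i)
  have hsum : ∑ k, tildeMatrix A b k j ^ 2 = a ⬝ᵥ a := by simp [dotProduct, sq, ha]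
  rw [hsum]
  nlinarith

end hat

/-! ### Splitting columns with small entries -/

/-- Vectors can be split into `K` groups whose sums all lie close to the mean. -/
lemma exists_balanced_coloring {ι E : Type*} [DecidableEq ι] [NormedAddCommGroup E]
    [InnerProductSpace ℝ E] {K : ℕ} (hK : 0 < K) (M : ι → E) (s : Finset ι) :
    ∃ σ : ι → Fin K, ∑ l, ‖∑ j ∈ s with σ j = l, M j - (K : ℝ)⁻¹ • ∑ j ∈ s, M j‖ ^ 2 ≤
      ∑ j ∈ s, ‖M j‖ ^ 2 := by
  have hK' : (0 : ℝ) < K := Nat.cast_pos.2 hK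
  induction s using Finset.induction_on with
  | empty => exact ⟨fun _ => ⟨0, hK⟩, by simp⟩
  | insert a s ha ih =>
    obtain ⟨σ, hσ⟩ := ih
    set D : Fin K → E := fun l => ∑ j ∈ s with σ j = l, M j - (K : ℝ)⁻¹ • ∑ j ∈ s, M j with hD
    have hDsum : ∑ l, D l = 0 := by
      simp only [hD, Finset.sum_sub_distrib, Finset.sum_const, Finset.card_univ, Fintype.card_fin]
      rw [Finset.sum_fiberwise, ← Nat.cast_smul_eq_nsmul ℝ, smul_smul, mul_inv_cancel₀ hK'.ne',
        one_smul, sub_self]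
    -- The deviations sum to zero, so one of them makes a nonpositive inner product with the new
    -- vector. Putting the vector there raises the total by at most `(1 - 1 / K) * ‖M a‖ ^ 2`.
    obtain ⟨l₀, -, hl₀⟩ : ∃ l ∈ Finset.univ, inner ℝ (D l) (M a) ≤ 0 := by
      refine Finset.exists_le_of_sum_le ⟨⟨0, hK⟩, Finset.mem_univ _⟩ ?_
      rw [← sum_inner, hDsum]
      simp
    refine ⟨Function.update σ a l₀, ?_⟩
    have hnew : ∀ l, ∑ j ∈ insert a s with Function.update σ a l₀ j = l, M j -
        (K : ℝ)⁻¹ • ∑ j ∈ insert a s, M j =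
        D l + ((if l = l₀ then 1 else 0) - (K : ℝ)⁻¹) • M a := by
      intro l
      have hfil : s.filter (fun j => Function.update σ a l₀ j = l) = s.filter fun j => σ j = l :=
        Finset.filter_congr fun j hj => by
          rw [Function.update_of_ne (ne_of_mem_of_not_mem hj ha)]
      rw [Finset.filter_insert, hfil, Function.update_self, Finset.sum_insert ha]
      by_cases h : l₀ = l
      · rw [if_pos h, if_pos h.symm, Finset.sum_insert (by simp [ha])]
        simp only [hD]
        module
      · rw [if_neg h, if_neg (Ne.symm h)]
        simp only [hD]
        module
    have hsq : ∀ l, ‖D l + ((if l = l₀ then 1 else 0) - (K : ℝ)⁻¹) • M a‖ ^ 2 =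
        ‖D l‖ ^ 2 + (if l = l₀ then 2 * inner ℝ (D l) (M a) else 0) -
        2 * (K : ℝ)⁻¹ * inner ℝ (D l) (M a) +
        ((if l = l₀ then 1 - 2 * (K : ℝ)⁻¹ else 0) + (K : ℝ)⁻¹ ^ 2) * ‖M a‖ ^ 2 := by
      intro l
      rw [norm_add_sq_real, norm_smul, mul_pow, Real.norm_eq_abs, sq_abs, inner_smul_right]
      split_ifs <;> ring
    simp only [hnew, hsq]
    rw [Finset.sum_add_distrib, Finset.sum_sub_distrib, Finset.sum_add_distrib, ← Finset.mul_sum,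
      ← Finset.sum_mul, Finset.sum_add_distrib, ← sum_inner, hDsum, Finset.sum_insert ha]
    simp only [Finset.sum_ite_eq', Finset.mem_univ, if_true, inner_zero_left, mul_zero, sub_zero,
      Finset.sum_const, Finset.card_univ, Fintype.card_fin, nsmul_eq_mul]
    have h1 : (K : ℝ) * (K : ℝ)⁻¹ ^ 2 = (K : ℝ)⁻¹ := by field_simp
    rw [h1]
    have h2 : 0 ≤ (K : ℝ)⁻¹ * ‖M a‖ ^ 2 := by positivity
    simp only [hD] at hl₀
    nlinarith

section gram

variable {m n : ℕ}

lemma columnsIn_mul_transpose_apply (B : Matrix (Fin m) (Fin n) ℝ) (I : Finset (Fin n))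
    (i k : Fin m) : (columnsIn B I * (columnsIn B I)ᵀ) i k = ∑ j ∈ I, B i j * B k j := by
  rw [Matrix.mul_apply]
  exact Finset.sum_coe_sort I fun j => B i j * B k j

/-- An empty group has Gram matrix zero, whose determinant is zero since `m > 0`. -/
lemma nonempty_of_det_columnsIn_pos (hm : 0 < m) {B : Matrix (Fin m) (Fin n) ℝ}
    {I : Finset (Fin n)} (h : 0 < (columnsIn B I * (columnsIn B I)ᵀ).det) : I.Nonempty := by
  rw [Finset.nonempty_iff_ne_empty]
  rintro rfl
  have h0 : columnsIn B ∅ * (columnsIn B ∅)ᵀ = 0 := by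
    ext i k
    rw [columnsIn_mul_transpose_apply]
    simp
  have : Nonempty (Fin m) := ⟨⟨0, hm⟩⟩
  rw [h0, det_zero] at h
  exact h.false

lemma sum_sq_row_eq_one {B : Matrix (Fin m) (Fin n) ℝ} (hB : B * Bᵀ = 1) (i : Fin m) :
    ∑ j, B i j ^ 2 = 1 := by
  have := congrFun (congrFun hB i) i
  rw [one_apply_eq, Matrix.mul_apply] at this
  simpa [sq] using this

lemma le_maxNorm (B : Matrix (Fin m) (Fin n) ℝ) (i : Fin m) (j : Fin n) : |B i j| ≤ maxNorm B :=
  le_ciSup (f := fun p : Fin m × Fin n => |B p.1 p.2|) (Set.finite_range _).bddAbove (i, j)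

lemma maxNorm_nonneg (B : Matrix (Fin m) (Fin n) ℝ) : 0 ≤ maxNorm B :=
  Real.iSup_nonneg fun _ => abs_nonneg _

lemma maxNorm_le {B : Matrix (Fin m) (Fin n) ℝ} {a : ℝ} (ha : 0 ≤ a) (h : ∀ i j, |B i j| ≤ a) :
    maxNorm B ≤ a :=
  Real.iSup_le (fun p => h p.1 p.2) ha

/-- Continuity of the determinant at `c • 1`. -/
lemma exists_det_lower_bound_near {c : ℝ} (hc : 0 < c) (m : ℕ) :
    ∃ δ > 0, ∀ G : Matrix (Fin m) (Fin m) ℝ,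
      (∀ i k, |G i k - c * (1 : Matrix (Fin m) (Fin m) ℝ) i k| < δ) → c ^ m / 2 ≤ G.det := by
  have hcont : ContinuousAt (fun G : Fin m → Fin m → ℝ => (Matrix.of G).det)
      (fun i k => c * (1 : Matrix (Fin m) (Fin m) ℝ) i k) := by
    have : Continuous fun G : Fin m → Fin m → ℝ => (Matrix.of G).det :=
      Continuous.matrix_det (by exact continuous_id)
    exact this.continuousAt
  have hdet : (Matrix.of fun i k => c * (1 : Matrix (Fin m) (Fin m) ℝ) i k).det = c ^ m := by
    have : (Matrix.of fun i k => c * (1 : Matrix (Fin m) (Fin m) ℝ) i k) =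
      c • (1 : Matrix (Fin m) (Fin m) ℝ) := rfl
    rw [this, det_smul]
    simp
  obtain ⟨δ, hδ, h⟩ := Metric.continuousAt_iff.1 hcont (c ^ m / 2) (by positivity)
  refine ⟨δ, hδ, fun G hG => ?_⟩
  have hdist := @h G ((dist_pi_lt_iff hδ).2 fun i => (dist_pi_lt_iff hδ).2 fun k => hG i k)
  rw [hdet, Real.dist_eq] at hdist
  have := (abs_lt.1 hdist).1
  have h2 : (Matrix.of G).det = G.det := rfl
  linarith

/-- A matrix with orthonormal rows and small entries has `K` disjoint groups of columns with Gram
determinants bounded below. -/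
lemma exists_disjoint_columns_of_small_entries (hm : 0 < m) {K : ℕ} (hK : 0 < K) :
    ∃ δ > 0, ∃ C > 0, ∀ (n : ℕ) (B : Matrix (Fin m) (Fin n) ℝ), B * Bᵀ = 1 → maxNorm B < δ →
      ∃ I : Fin K → Finset (Fin n), (∀ l, (I l).Nonempty) ∧
        (∀ l l', l ≠ l' → Disjoint (I l) (I l')) ∧
        ∀ l, C ≤ (columnsIn B (I l) * (columnsIn B (I l))ᵀ).det := by
  have hc : (0 : ℝ) < (K : ℝ)⁻¹ := inv_pos.2 (Nat.cast_pos.2 hK)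
  have hm' : (0 : ℝ) < m := Nat.cast_pos.2 hm
  obtain ⟨δ, hδ, hdet⟩ := exists_det_lower_bound_near hc m
  refine ⟨δ / m, by positivity, (K : ℝ)⁻¹ ^ m / 2, by positivity, fun n B hB hsmall => ?_⟩
  -- The rank-one matrices of the columns, with the Frobenius norm; they sum to the identity.
  set M : Fin n → EuclideanSpace ℝ (Fin m × Fin m) :=
    fun j => WithLp.toLp 2 fun p => B p.1 j * B p.2 j with hM
  obtain ⟨σ, hσ⟩ := exists_balanced_coloring hK M Finset.univ
  have hMnorm : ∑ j, ‖M j‖ ^ 2 ≤ (m * maxNorm B) ^ 2 := by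
    have hj : ∀ j, ‖M j‖ ^ 2 ≤ (m * maxNorm B ^ 2) * ∑ i, B i j ^ 2 := by
      intro j
      have h1 : ‖M j‖ ^ 2 = (∑ i, B i j ^ 2) * ∑ i, B i j ^ 2 := by
        rw [EuclideanSpace.real_norm_sq_eq, Finset.sum_mul_sum, ← Finset.univ_product_univ,
          Finset.sum_product]
        simp [hM, mul_pow]
      rw [h1]
      refine mul_le_mul_of_nonneg_right ?_ (Finset.sum_nonneg fun i _ => sq_nonneg _)
      calc ∑ i, B i j ^ 2 ≤ ∑ _i : Fin m, maxNorm B ^ 2 :=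
            Finset.sum_le_sum fun i _ => by
              rw [← sq_abs]
              exact pow_le_pow_left₀ (abs_nonneg _) (le_maxNorm B i j) 2
        _ = m * maxNorm B ^ 2 := by simp
    calc ∑ j, ‖M j‖ ^ 2 ≤ ∑ j, (m * maxNorm B ^ 2) * ∑ i, B i j ^ 2 :=
          Finset.sum_le_sum fun j _ => hj j
      _ = (m * maxNorm B) ^ 2 := by
          rw [← Finset.mul_sum, Finset.sum_comm]
          simp only [sum_sq_row_eq_one hB]
          simp
          ring
  have hdetl : ∀ l, (K : ℝ)⁻¹ ^ m / 2 ≤ (columnsIn B (Finset.univ.filter fun j => σ j = l) *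
      (columnsIn B (Finset.univ.filter fun j => σ j = l))ᵀ).det := by
    refine fun l => hdet _ fun i k => ?_
    rw [columnsIn_mul_transpose_apply]
    have hone : (1 : Matrix (Fin m) (Fin m) ℝ) i k = ∑ j, B i j * B k j := by
      rw [← hB, Matrix.mul_apply]
      rfl
    set x := ∑ j with σ j = l, M j - (K : ℝ)⁻¹ • ∑ j, M j with hx
    have hxik : ∑ j with σ j = l, B i j * B k j -
        (K : ℝ)⁻¹ * (1 : Matrix (Fin m) (Fin m) ℝ) i k = x (i, k) := by
      rw [hone, hx]
      simp [hM]
    rw [hxik]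
    have h1 : ‖x‖ ^ 2 ≤ (m * maxNorm B) ^ 2 :=
      ((Finset.single_le_sum (f := fun l => ‖∑ j with σ j = l, M j - (K : ℝ)⁻¹ • ∑ j, M j‖ ^ 2)
        (fun _ _ => sq_nonneg _) (Finset.mem_univ l)).trans hσ).trans hMnorm
    have h2 : ‖x‖ ≤ m * maxNorm B :=
      le_of_sq_le_sq h1 (mul_nonneg hm'.le (maxNorm_nonneg B))
    calc |x (i, k)| ≤ ‖x‖ := PiLp.norm_apply_le x (i, k)
      _ ≤ m * maxNorm B := h2
      _ < m * (δ / m) := mul_lt_mul_of_pos_left hsmall hm'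
      _ = δ := by field_simp
  refine ⟨fun l => Finset.univ.filter fun j => σ j = l, fun l => ?_, fun l l' hll' => ?_, hdetl⟩
  · exact nonempty_of_det_columnsIn_pos hm (lt_of_lt_of_le (by positivity) (hdetl l))
  · exact Finset.disjoint_filter.2 fun j _ h h' => hll' (h.symm.trans h')

end gram

/-! ### Splitting repeated columns -/

/-- A finite set with at least `K` elements splits into `K` classes of comparable size. -/
lemma exists_coloring_of_le_card {ι : Type*} {K : ℕ} (hK : 0 < K) {s : Finset ι} (hs : K ≤ s.card) :
    ∃ τ : ι → Fin K, ∀ l, s.card ≤ 2 * K * (s.filter fun k => τ k = l).card := by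
  classical
  -- Indices modulo `K` in an enumeration of `s`. Each class has at least `s.card / K ≥ 1` elements;
  -- rounding down costs the factor 2.
  let τ : ι → Fin K := fun k => if h : k ∈ s then ⟨(s.equivFin ⟨k, h⟩ : ℕ) % K, Nat.mod_lt _ hK⟩
    else ⟨0, hK⟩
  refine ⟨τ, fun l => ?_⟩
  have hlt : ∀ q : Fin (s.card / K), (q : ℕ) * K + l < s.card := fun q => by
    calc (q : ℕ) * K + l < q * K + K := by omega
      _ = (q + 1) * K := by ring
      _ ≤ (s.card / K) * K := Nat.mul_le_mul_right _ q.2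
      _ ≤ s.card := Nat.div_mul_le_self _ _
  have hcard : s.card / K ≤ (s.filter fun k => τ k = l).card := by
    have h := Finset.card_le_card_of_injOn (s := (Finset.univ : Finset (Fin (s.card / K))))
      (t := s.filter fun k => τ k = l) (fun q => (s.equivFin.symm ⟨q * K + l, hlt q⟩ : ι))
      (fun q _ => by
        simp only [Finset.coe_filter, Set.mem_ofPred_eq]
        refine ⟨Subtype.prop _, ?_⟩
        simp only [τ, Subtype.prop, dif_pos, Subtype.coe_eta, Equiv.apply_symm_apply]
        ext
        simp [Nat.mod_eq_of_lt l.2])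
      (fun q _ q' _ h => by
        have := s.equivFin.symm.injective (Subtype.ext h)
        simp only [Fin.mk.injEq, Nat.add_right_cancel_iff] at this
        exact Fin.ext (Nat.eq_of_mul_eq_mul_right hK this))
    simpa using h
  have h1 : 1 ≤ s.card / K := (Nat.one_le_div_iff hK).2 hs
  calc s.card = K * (s.card / K) + s.card % K := (Nat.div_add_mod _ _).symm
    _ ≤ K * (s.card / K) + K * (s.card / K) := by
      have := Nat.mod_lt s.card hK
      nlinarith
    _ = 2 * K * (s.card / K) := by ring
    _ ≤ _ := Nat.mul_le_mul_left _ hcard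

/-- If every fibre of `f` has at least `K` elements, all fibres can be split simultaneously. -/
lemma exists_coloring_sum_le {ι α : Type*} [Fintype ι] [DecidableEq α] {K : ℕ} (hK : 0 < K)
    (f : ι → α) (hf : ∀ j, K ≤ (Finset.univ.filter fun k => f k = f j).card) :
    ∃ σ : ι → Fin K, ∀ g : ι → ℝ, (∀ j, 0 ≤ g j) → (∀ j k, f k = f j → g k = g j) →
      ∀ l, ∑ j, g j ≤ 2 * K * ∑ j with σ j = l, g j := by
  choose τ hτ using fun j => exists_coloring_of_le_card hK (hf j)
  -- `τ j` depends on the representative `j`; one colouring per value of `f` is needed.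
  have hex : ∀ c, ∃ ρ : ι → Fin K, ∀ j, f j = c → ∀ l,
      (Finset.univ.filter fun k => f k = c).card ≤
        2 * K * ((Finset.univ.filter fun k => f k = c).filter fun k => ρ k = l).card := by
    intro c
    by_cases h : ∃ j, f j = c
    · obtain ⟨j, rfl⟩ := h
      exact ⟨τ j, fun _ _ => hτ j⟩
    · exact ⟨fun _ => ⟨0, hK⟩, fun j hj => (h ⟨j, hj⟩).elim⟩
  choose ρ hρ using hex
  refine ⟨fun k => ρ (f k) k, fun g hg hgf l => ?_⟩
  rw [← Finset.sum_fiberwise_of_maps_to (t := Finset.univ.image f)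
      (fun j _ => Finset.mem_image_of_mem f (Finset.mem_univ j)) g,
    ← Finset.sum_fiberwise_of_maps_to (t := Finset.univ.image f)
      (fun j _ => Finset.mem_image_of_mem f (Finset.mem_univ j)) g, Finset.mul_sum]
  refine Finset.sum_le_sum fun c hc => ?_
  obtain ⟨j, -, rfl⟩ := Finset.mem_image.1 hc
  have h1 : ∑ k with f k = f j, g k = (Finset.univ.filter fun k => f k = f j).card * g j := by
    rw [Finset.sum_congr rfl fun k hk => hgf j k (Finset.mem_filter.1 hk).2]
    simp
  have h2 : ∑ k ∈ (Finset.univ.filter fun k => ρ (f k) k = l) with f k = f j, g k =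
      ((Finset.univ.filter fun k => f k = f j).filter fun k => ρ (f j) k = l).card * g j := by
    have : (Finset.univ.filter fun k => ρ (f k) k = l).filter (fun k => f k = f j) =
        (Finset.univ.filter fun k => f k = f j).filter fun k => ρ (f j) k = l := by
      ext k
      simp only [Finset.mem_filter, Finset.mem_univ, true_and]
      constructor <;> rintro ⟨h, h'⟩
      · exact ⟨h', h' ▸ h⟩
      · exact ⟨by rw [h]; exact h', h⟩
    rw [this, Finset.sum_congr rfl fun k hk =>
      hgf j k (Finset.mem_filter.1 (Finset.mem_filter.1 hk).1).2]
    simp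
  rw [h1, h2, ← mul_assoc]
  refine mul_le_mul_of_nonneg_right ?_ (hg j)
  exact_mod_cast hρ (f j) j rfl l

/-- Testing the form on eigenvectors bounds every eigenvalue below by `c`. -/
lemma pow_le_det {m : ℕ} {M : Matrix (Fin m) (Fin m) ℝ} (hM : M.IsHermitian) {c : ℝ} (hc : 0 ≤ c)
    (h : ∀ z, c * (z ⬝ᵥ z) ≤ z ⬝ᵥ (M *ᵥ z)) : c ^ m ≤ M.det := by
  have heig : ∀ i, c ≤ hM.eigenvalues i := by
    intro i
    set z : Fin m → ℝ := (hM.eigenvectorBasis i).ofLp with hz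
    have hMz : M *ᵥ z = hM.eigenvalues i • z := hM.mulVec_eigenvectorBasis i
    have h1 := h z
    rw [hMz, dotProduct_smul, smul_eq_mul] at h1
    have hne : z ≠ 0 := fun h0 => hM.eigenvectorBasis.orthonormal.ne_zero i (by
      ext k
      exact congrFun h0 k)
    have hpos : 0 < z ⬝ᵥ z := lt_of_le_of_ne (Finset.sum_nonneg fun i _ => mul_self_nonneg _)
      fun h0 => hne (dotProduct_self_eq_zero.1 h0.symm)
    exact le_of_mul_le_mul_right h1 hpos
  rw [hM.det_eq_prod_eigenvalues]
  calc c ^ m = ∏ _i : Fin m, c := by simp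
    _ ≤ _ := Finset.prod_le_prod (fun _ _ => hc) fun i _ => heig i

section gram

variable {m n : ℕ}

lemma dotProduct_mul_transpose_mulVec {ι : Type*} [Fintype ι] (B : Matrix (Fin m) ι ℝ)
    (z : Fin m → ℝ) : z ⬝ᵥ ((B * Bᵀ) *ᵥ z) = ∑ j, ((z ᵥ* B) j) ^ 2 := by
  rw [← mulVec_mulVec, mulVec_transpose, dotProduct_mulVec]
  simp [dotProduct, sq]

/-- A matrix with orthonormal rows each of whose columns is repeated at least `K` times has `K`
disjoint groups of columns with Gram determinants bounded below. -/
lemma exists_disjoint_columns_of_repeated {α : Type*} (hm : 0 < m) {K : ℕ} (hK : 0 < K)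
    {B : Matrix (Fin m) (Fin n) ℝ} (hB : B * Bᵀ = 1) (f : Fin n → α)
    (hf : ∀ j, K ≤ {k | f k = f j}.ncard) (hfB : ∀ j k, f k = f j → ∀ i, B i k = B i j) :
    ∃ I : Fin K → Finset (Fin n), (∀ l, (I l).Nonempty) ∧
      (∀ l l', l ≠ l' → Disjoint (I l) (I l')) ∧
      ∀ l, ((2 * K : ℝ)⁻¹) ^ m ≤ (columnsIn B (I l) * (columnsIn B (I l))ᵀ).det := by
  classical
  have hK' : (0 : ℝ) < K := Nat.cast_pos.2 hK
  obtain ⟨σ, hσ⟩ := exists_coloring_sum_le hK f fun j => by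
    simpa [Set.ncard_eq_toFinset_card'] using hf j
  have hdet : ∀ l, ((2 * K : ℝ)⁻¹) ^ m ≤ (columnsIn B (Finset.univ.filter fun j => σ j = l) *
      (columnsIn B (Finset.univ.filter fun j => σ j = l))ᵀ).det := by
    intro l
    refine pow_le_det ?_ (by positivity) fun z => ?_
    · rw [IsHermitian, conjTranspose_eq_transpose_of_trivial, transpose_mul, transpose_transpose]
    -- The colouring does not depend on `z`, so one grouping serves the whole quadratic form.
    · have h := hσ (fun j => ((z ᵥ* B) j) ^ 2) (fun j => sq_nonneg _) (fun j k hjk => by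
        simp only [vecMul, dotProduct, hfB j k hjk]) l
      rw [← dotProduct_mul_transpose_mulVec, hB, one_mulVec] at h
      rw [dotProduct_mul_transpose_mulVec, inv_mul_le_iff₀ (by positivity)]
      refine h.trans_eq ?_
      rw [← Finset.sum_coe_sort]
      rfl
  refine ⟨fun l => Finset.univ.filter fun j => σ j = l, fun l => ?_, fun l l' hll' => ?_, hdet⟩
  · exact nonempty_of_det_columnsIn_pos hm (lt_of_lt_of_le (by positivity) (hdet l))
  · exact Finset.disjoint_filter.2 fun j _ h h' => hll' (h.symm.trans h')

/-- An entry of a matrix with orthonormal rows is small when its column is repeated often. -/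
lemma mul_sq_le_one_of_repeated {B : Matrix (Fin m) (Fin n) ℝ} (hB : B * Bᵀ = 1) {R : ℕ}
    {s : Set (Fin n)} (hs : R ≤ s.ncard) {i : Fin m} {j : Fin n} (hsB : ∀ k ∈ s, B i k = B i j) :
    R * B i j ^ 2 ≤ 1 := by
  classical
  rw [Set.ncard_eq_toFinset_card'] at hs
  calc R * B i j ^ 2 ≤ s.toFinset.card * B i j ^ 2 :=
        mul_le_mul_of_nonneg_right (Nat.cast_le.2 hs) (sq_nonneg _)
    _ = ∑ k ∈ s.toFinset, B i k ^ 2 := by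
        rw [Finset.sum_congr rfl fun k hk => by rw [hsB k (Set.mem_toFinset.1 hk)]]
        simp
    _ ≤ ∑ k, B i k ^ 2 :=
        Finset.sum_le_sum_of_subset_of_nonneg (Finset.subset_univ _) fun _ _ _ => sq_nonneg _
    _ = 1 := sum_sq_row_eq_one hB i

end gram

/-! ### Property A and repeated columns for the hat matrix -/

/-- For `m = 0` the row space is zero, but it contains the positive weight vector. -/
lemma IsNondegenerate.rows_pos {m n : ℕ} {A : Matrix (Fin m) (Fin n) ℝ} {b : Fin m → ℝ}
    (h : IsNondegenerate A b) (hn : m < n) : 0 < m := by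
  obtain ⟨v, hv, hw, -⟩ := h.exists_weight
  by_contra h0
  obtain rfl : m = 0 := by omega
  have := hw ⟨0, hn⟩
  rw [← hv] at this
  simp [vecMul, dotProduct] at this

theorem propertyA_of_tendsto_maxNorm {m : ℕ} {A : ∀ n, Matrix (Fin m) (Fin n) ℝ}
    {b : ℕ → Fin m → ℝ} (hnd : ∀ n, m < n → IsNondegenerate (A n) (b n))
    (h : Tendsto (fun n => maxNorm (hatMatrix (A n) (b n))) atTop (𝓝 0)) :
    PropertyA (fun n => hatMatrix (A n) (b n)) := by
  have hm : 0 < m := (hnd (m + 1) (Nat.lt_succ_self m)).rows_pos (Nat.lt_succ_self m)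
  intro K
  rcases Nat.eq_zero_or_pos K with rfl | hK
  · exact ⟨0, 1, one_pos, fun n _ => ⟨fun _ => ∅, fun l => l.elim0, fun l => l.elim0,
      fun l => l.elim0⟩⟩
  obtain ⟨δ, hδ, C, hC, hI⟩ := exists_disjoint_columns_of_small_entries hm hK
  obtain ⟨n₀, hn₀⟩ := eventually_atTop.1 ((h.eventually_lt_const hδ).and (eventually_gt_atTop m))
  exact ⟨n₀, C, hC, fun n hn =>
    hI n _ (hnd n (hn₀ n hn).2).hatMatrix_mul_transpose (hn₀ n hn).1⟩

theorem propertyAFor_of_le_columnMultiplicity {m : ℕ} {A : ∀ n, Matrix (Fin m) (Fin n) ℝ}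
    {b : ℕ → Fin m → ℝ} (hnd : ∀ n, m < n → IsNondegenerate (A n) (b n)) {K n₀ : ℕ} (hn₀ : m < n₀)
    (h : ∀ n, n₀ ≤ n → ∀ j, K ≤ columnMultiplicity (A n) j) :
    PropertyAFor (fun n => hatMatrix (A n) (b n)) K n₀ := by
  have hm : 0 < m := (hnd n₀ hn₀).rows_pos hn₀
  rcases Nat.eq_zero_or_pos K with rfl | hK
  · exact ⟨1, one_pos, fun n _ => ⟨fun _ => ∅, fun l => l.elim0, fun l => l.elim0,
      fun l => l.elim0⟩⟩
  refine ⟨((2 * K : ℝ)⁻¹) ^ m, by positivity, fun n hn => ?_⟩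
  have hndn := hnd n (hn₀.trans_le hn)
  exact exists_disjoint_columns_of_repeated hm hK hndn.hatMatrix_mul_transpose
    (fun j i => A n i j) (fun j => by simpa [columnMultiplicity, funext_iff] using h n hn j)
    fun j k hjk => hndn.hatMatrix_column_eq (congrFun hjk)

theorem tendsto_maxNorm_of_columnMultiplicity {m : ℕ} {A : ∀ n, Matrix (Fin m) (Fin n) ℝ}
    {b : ℕ → Fin m → ℝ} (hnd : ∀ n, m < n → IsNondegenerate (A n) (b n))
    (h : ∀ R : ℕ, ∀ᶠ n in atTop, ∀ j, R ≤ columnMultiplicity (A n) j) :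
    Tendsto (fun n => maxNorm (hatMatrix (A n) (b n))) atTop (𝓝 0) := by
  refine tendsto_order.2 ⟨fun a ha => Eventually.of_forall fun n =>
    ha.trans_le (maxNorm_nonneg _), fun a ha => ?_⟩
  -- Entries are at most `R ^ (-1/2)`; `a / 2` leaves room for a strict bound on the supremum.
  obtain ⟨R, hR⟩ := exists_nat_gt ((a / 2) ^ 2)⁻¹
  filter_upwards [h R, eventually_gt_atTop m] with n hn hmn
  refine lt_of_le_of_lt (maxNorm_le (by positivity : 0 ≤ a / 2) fun i j => ?_) (half_lt_self ha)
  have h1 := mul_sq_le_one_of_repeated (hnd n hmn).hatMatrix_mul_transpose (hn j) (i := i) (j := j)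
    fun k hk => (hnd n hmn).hatMatrix_column_eq hk i
  have hR0 : 0 < ((a / 2) ^ 2)⁻¹ := by positivity
  have h2 : hatMatrix (A n) (b n) i j ^ 2 ≤ (a / 2) ^ 2 := by
    by_contra hlt
    push Not at hlt
    have h3 : ((a / 2) ^ 2)⁻¹ * (a / 2) ^ 2 = 1 := inv_mul_cancel₀ (by positivity)
    have h4 := mul_lt_mul'' hR hlt hR0.le (sq_nonneg _)
    linarith
  exact abs_le_of_sq_le_sq h2 (by positivity)

/-! ### Solving for the weight near an approximate solution -/

/-- With `1 + t = s ^ 2`, `log (1 + t) ≤ 2 * (s - 1) = t - (s - 1) ^ 2`, and `t = (s - 1) * (s + 1)`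
with `(s + 1) ^ 2 ≤ 6`. The quadratic term is the strict concavity used below. -/
lemma log_one_add_le_sub_sq {t : ℝ} (h0 : -1 < t) (h1 : t ≤ 1) :
    Real.log (1 + t) ≤ t - t ^ 2 / 6 := by
  have hpos : 0 < 1 + t := by linarith
  set s := Real.sqrt (1 + t) with hs
  have hs0 : 0 < s := Real.sqrt_pos.2 hpos
  have hss : s ^ 2 = 1 + t := Real.sq_sqrt hpos.le
  have hlog : Real.log (1 + t) ≤ 2 * (s - 1) := by
    rw [← hss, Real.log_pow]
    have := Real.log_le_sub_one_of_pos hs0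
    push_cast
    linarith
  have hs1 : s ≤ 1.42 := by nlinarith
  have h6 : (s + 1) ^ 2 ≤ 6 := by nlinarith
  have ht : t = (s - 1) * (s + 1) := by linarith
  have hsq : t ^ 2 ≤ 6 * (s - 1) ^ 2 := by
    rw [ht, mul_pow, mul_comm]
    exact mul_le_mul_of_nonneg_right h6 (sq_nonneg _)
  nlinarith

section deterministic

variable {m n : ℕ} {A : Matrix (Fin m) (Fin n) ℝ} {b v : Fin m → ℝ}

lemma abs_dotProduct_le (h e : Fin m → ℝ) : |h ⬝ᵥ e| ≤ ‖h‖ * ∑ i, |e i| := by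
  rw [Finset.mul_sum]
  refine (Finset.abs_sum_le_sum_abs _ _).trans (Finset.sum_le_sum fun i _ => ?_)
  rw [abs_mul]
  exact mul_le_mul_of_nonneg_right (norm_le_pi_norm h i) (abs_nonneg _)

lemma dotProduct_self_nonneg' (z : Fin m → ℝ) : 0 ≤ z ⬝ᵥ z :=
  Finset.sum_nonneg fun _ _ => mul_self_nonneg _

lemma sq_norm_le_dotProduct_self (z : Fin m → ℝ) : ‖z‖ ^ 2 ≤ z ⬝ᵥ z := by
  have h : ‖z‖ ≤ Real.sqrt (z ⬝ᵥ z) := (pi_norm_le_iff_of_nonneg (Real.sqrt_nonneg _)).2 fun i =>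
    Real.abs_le_sqrt (by
      rw [sq]
      exact Finset.single_le_sum (f := fun k => z k * z k) (fun k _ => mul_self_nonneg _)
        (Finset.mem_univ i))
  calc ‖z‖ ^ 2 ≤ Real.sqrt (z ⬝ᵥ z) ^ 2 := pow_le_pow_left₀ (norm_nonneg _) h 2
    _ = z ⬝ᵥ z := Real.sq_sqrt (dotProduct_self_nonneg' z)

lemma dotProduct_self_le_sq_norm (z : Fin m → ℝ) : z ⬝ᵥ z ≤ m * ‖z‖ ^ 2 := by
  calc z ⬝ᵥ z ≤ ∑ _i : Fin m, ‖z‖ ^ 2 := Finset.sum_le_sum fun i _ => by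
        rw [← sq, ← sq_abs]
        exact pow_le_pow_left₀ (abs_nonneg _) (norm_le_pi_norm z i) 2
    _ = m * ‖z‖ ^ 2 := by simp

/-- If `v` nearly solves `n⁻¹ ∑ uⱼ / ⟨v, uⱼ⟩ = b`, where `uⱼ` are the columns of `A`, then there is
an exact solution close to `v`: the maximizer of a concave function on a ball about `v`. -/
lemma exists_sum_column_div_eq (hp : ∀ j, 0 < (v ᵥ* A) j) {r : ℝ} (hr : 0 < r)
    (hsmall : ∀ h : Fin m → ℝ, ‖h‖ ≤ r → ∀ j, |(h ᵥ* A) j| ≤ (v ᵥ* A) j / 2)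
    {c : ℝ} (hc : 0 < c)
    (hq : ∀ z, c * (z ⬝ᵥ z) ≤ (n : ℝ)⁻¹ * ∑ j, ((z ᵥ* A) j / (v ᵥ* A) j) ^ 2)
    (he : ∑ i, |(n : ℝ)⁻¹ * ∑ j, A i j / (v ᵥ* A) j - b i| < c * r / 6) :
    ∃ v', (∀ j, |(v' ᵥ* A) j - (v ᵥ* A) j| ≤ (v ᵥ* A) j / 2) ∧
      ∀ i, (n : ℝ)⁻¹ * ∑ j, A i j / (v' ᵥ* A) j = b i := by
  set p := v ᵥ* A with hpdef
  -- The gradient of `G` at `h` is the error of `v + h` in the equation to be solved.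
  set G : (Fin m → ℝ) → ℝ := fun h => (n : ℝ)⁻¹ * ∑ j, Real.log (p j + (h ᵥ* A) j) - h ⬝ᵥ b
    with hG
  have hpos : ∀ h : Fin m → ℝ, ‖h‖ ≤ r → ∀ j, 0 < p j + (h ᵥ* A) j := fun h hh j => by
    have := (abs_le.1 (hsmall h hh j)).1
    have := hp j
    linarith
  have hcont : ContinuousOn G (Metric.closedBall 0 r) := by
    refine (continuousOn_const.mul (continuousOn_finsetSum _ fun j _ =>
      ContinuousOn.log ?_ fun h hh => (hpos h (by simpa using hh) j).ne')).sub ?_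
    · exact (continuous_const.add ((continuous_apply j).comp
        (continuous_id.matrix_vecMul continuous_const))).continuousOn
    · exact (continuous_id.dotProduct continuous_const).continuousOn
  obtain ⟨h₀, hh₀, hmax⟩ := (isCompact_closedBall (0 : Fin m → ℝ) r).exists_isMaxOn
    ⟨0, by simpa using hr.le⟩ hcont
  -- On the sphere the linear term is below `c * r ^ 2 / 6` by `he`, and the quadratic loss is at
  -- least that by `hq`; so the maximizer is interior.
  have hboundary : ∀ h : Fin m → ℝ, ‖h‖ = r → G h < G 0 := by
    intro h hh
    have hlog : ∀ j, Real.log (p j + (h ᵥ* A) j) ≤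
        Real.log (p j) + ((h ᵥ* A) j / p j - ((h ᵥ* A) j / p j) ^ 2 / 6) := by
      intro j
      have h1 := abs_le.1 (hsmall h hh.le j)
      have hpj := hp j
      have hfac : p j + (h ᵥ* A) j = p j * (1 + (h ᵥ* A) j / p j) := by field_simp
      have hlo : -1 < (h ᵥ* A) j / p j := by
        rw [lt_div_iff₀ hpj]
        linarith [h1.1]
      have hhi : (h ᵥ* A) j / p j ≤ 1 := by
        rw [div_le_iff₀ hpj]
        linarith [h1.2]
      rw [hfac, Real.log_mul hpj.ne' (by linarith)]
      gcongr
      exact log_one_add_le_sub_sq hlo hhi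
    have hsum := mul_le_mul_of_nonneg_left (Finset.sum_le_sum fun j (_ : j ∈ Finset.univ) => hlog j)
      (inv_nonneg.2 (Nat.cast_nonneg n : (0 : ℝ) ≤ n))
    rw [Finset.sum_add_distrib, Finset.sum_sub_distrib, ← Finset.sum_div] at hsum
    have hlin : (n : ℝ)⁻¹ * ∑ j, (h ᵥ* A) j / p j - h ⬝ᵥ b =
        h ⬝ᵥ fun i => (n : ℝ)⁻¹ * ∑ j, A i j / p j - b i := by
      have : (n : ℝ)⁻¹ * ∑ j, (h ᵥ* A) j / p j =
          ∑ i, h i * ((n : ℝ)⁻¹ * ∑ j, A i j / p j) := by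
        simp only [vecMul, dotProduct, Finset.sum_div, Finset.mul_sum]
        rw [Finset.sum_comm]
        exact Finset.sum_congr rfl fun i _ => Finset.sum_congr rfl fun j _ => by ring
      rw [this]
      simp only [dotProduct, mul_sub, Finset.sum_sub_distrib]
    have herr := (le_abs_self _).trans
      (abs_dotProduct_le h fun i => (n : ℝ)⁻¹ * ∑ j, A i j / p j - b i)
    rw [← hlin, hh] at herr
    have hquad := hq h
    have hsq := sq_norm_le_dotProduct_self h
    rw [hh] at hsq
    have h3 := mul_le_mul_of_nonneg_left hsq hc.le
    have h4 := mul_lt_mul_of_pos_left he hr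
    have hG0 : G 0 = (n : ℝ)⁻¹ * ∑ j, Real.log (p j) := by simp [hG]
    rw [hG0]
    simp only [hG]
    nlinarith
  have hlt : ‖h₀‖ < r := by
    have h1 : ‖h₀‖ ≤ r := by simpa using hh₀
    refine h1.lt_of_ne fun h => ?_
    have h2 : G 0 ≤ G h₀ := hmax (by simpa using hr.le)
    exact (hboundary h₀ h).not_ge h2
  have hloc : IsLocalMax G h₀ := hmax.isLocalMax
    (Filter.mem_of_superset (Metric.isOpen_ball.mem_nhds (by simpa using hlt))
      Metric.ball_subset_closedBall)
  refine ⟨v + h₀, fun j => ?_, fun i => ?_⟩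
  · rw [add_vecMul, Pi.add_apply, ← hpdef, add_sub_cancel_left]
    exact hsmall h₀ hlt.le j
  · set γ : ℝ → Fin m → ℝ := fun s => h₀ + s • Pi.single i 1 with hγ
    have hγ0 : γ 0 = h₀ := by simp [hγ]
    have hγc : ContinuousAt γ 0 := by fun_prop
    have hloc' : IsLocalMax (fun s => G (γ s)) 0 := by
      have hloc0 : ∀ᶠ h in 𝓝 (γ 0), G h ≤ G (γ 0) := by
        rw [hγ0]
        exact hloc
      exact hγc.eventually hloc0
    have hGγ : (fun s => G (γ s)) = fun s : ℝ =>
        (n : ℝ)⁻¹ * ∑ j, Real.log (((v + h₀) ᵥ* A) j + s * A i j) - (h₀ ⬝ᵥ b + s * b i) := by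
      ext s
      have h1 : ∀ j, p j + (γ s ᵥ* A) j = ((v + h₀) ᵥ* A) j + s * A i j := fun j => by
        simp [hγ, hpdef, add_vecMul, smul_vecMul, add_assoc]
      simp only [hG, h1]
      simp [hγ, add_dotProduct]
    have hder : HasDerivAt (fun s : ℝ => (n : ℝ)⁻¹ * ∑ j, Real.log (((v + h₀) ᵥ* A) j + s * A i j) -
        (h₀ ⬝ᵥ b + s * b i))
        ((n : ℝ)⁻¹ * ∑ j, A i j / (((v + h₀) ᵥ* A) j + 0 * A i j) - b i) 0 := by
      refine (HasDerivAt.const_mul _ (HasDerivAt.fun_sum fun j _ => HasDerivAt.log ?_ ?_)).sub ?_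
      · simpa using ((hasDerivAt_id (0 : ℝ)).mul_const (A i j)).const_add (((v + h₀) ᵥ* A) j)
      · have := hpos h₀ hlt.le j
        rw [hpdef, ← Pi.add_apply, ← add_vecMul] at this
        simpa using this.ne'
      · simpa using ((hasDerivAt_id (0 : ℝ)).mul_const (b i)).const_add (h₀ ⬝ᵥ b)
    rw [hGγ] at hloc'
    have := hloc'.hasDerivAt_eq_zero hder
    simpa [sub_eq_zero] using this

/-- A positive combination of the coordinates is constant on the polytope, which bounds each of
them. -/
lemma isCompact_polytope_of_vecMul_pos (hw : ∀ j, 0 < (v ᵥ* A) j) : IsCompact (polytope A b) := by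
  have hsub : polytope A b ⊆ Set.pi Set.univ fun j => Set.Icc 0 (v ⬝ᵥ b / (v ᵥ* A) j) := by
    intro y hy j _
    refine ⟨hy.1 j, ?_⟩
    rw [le_div_iff₀ (hw j), ← vecMul_dotProduct_of_mem_polytope v hy, mul_comm]
    exact Finset.single_le_sum (f := fun k => (v ᵥ* A) k * y k)
      (fun k _ => mul_nonneg (hw k).le (hy.1 k)) (Finset.mem_univ j)
  refine (isCompact_univ_pi fun j => isCompact_Icc).of_isClosed_subset ?_ hsub
  have hset : polytope A b = (⋂ j, {x : Fin n → ℝ | 0 ≤ x j}) ∩ {x | A *ᵥ x = b} := by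
    ext x
    simp [polytope]
  rw [hset]
  exact (isClosed_iInter fun j => isClosed_le continuous_const (continuous_apply j)).inter
    (isClosed_eq (continuous_const.matrix_mulVec continuous_id) continuous_const)

/-- Under the hypotheses of `exists_sum_column_div_eq` the pair is nondegenerate, and the entries of
the hat matrix are of order `n^(-1/2)`. -/
lemma isNondegenerate_and_sq_hatMatrix_le (hn : 0 < n) {p₀ R : ℝ} (hp₀ : 0 < p₀)
    (hp : ∀ j, p₀ ≤ (v ᵥ* A) j) (hR : ∀ i j, |A i j| ≤ R) {r : ℝ} (hr : 0 < r)
    (hsmall : ∀ h : Fin m → ℝ, ‖h‖ ≤ r → ∀ j, |(h ᵥ* A) j| ≤ (v ᵥ* A) j / 2)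
    {c : ℝ} (hc : 0 < c)
    (hq : ∀ z, c * (z ⬝ᵥ z) ≤ (n : ℝ)⁻¹ * ∑ j, ((z ᵥ* A) j / (v ᵥ* A) j) ^ 2)
    (he : ∑ i, |(n : ℝ)⁻¹ * ∑ j, A i j / (v ᵥ* A) j - b i| < c * r / 6) :
    IsNondegenerate A b ∧
      ∀ i j, hatMatrix A b i j ^ 2 ≤ 16 * m * R ^ 2 / (c * p₀ ^ 2) * (n : ℝ)⁻¹ := by
  have hn' : (0 : ℝ) < n := Nat.cast_pos.2 hn
  have hppos : ∀ j, 0 < (v ᵥ* A) j := fun j => hp₀.trans_le (hp j)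
  obtain ⟨v', hv', hb⟩ := exists_sum_column_div_eq hppos hr hsmall hc hq he
  have hlo : ∀ j, (v ᵥ* A) j / 2 ≤ (v' ᵥ* A) j := fun j => by
    have := (abs_le.1 (hv' j)).1
    linarith
  have hhi : ∀ j, (v' ᵥ* A) j ≤ 2 * (v ᵥ* A) j := fun j => by
    have := (abs_le.1 (hv' j)).2
    linarith [hppos j]
  have hq0 : ∀ j, 0 < (v' ᵥ* A) j := fun j => (half_pos (hppos j)).trans_le (hlo j)
  -- The factor `n` turns the average in `hb` into `A *ᵥ (1 / w) = b`.
  have hw : ∀ j, (((n : ℝ) • v') ᵥ* A) j = n * (v' ᵥ* A) j := fun j => by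
    rw [smul_vecMul, Pi.smul_apply, smul_eq_mul]
  have hwpos : ∀ j, 0 < (((n : ℝ) • v') ᵥ* A) j := fun j => by
    rw [hw]
    exact mul_pos hn' (hq0 j)
  have hmem : (fun j => 1 / (((n : ℝ) • v') ᵥ* A) j) ∈ polytope A b := by
    refine ⟨fun j => (one_div_pos.2 (hwpos j)).le, funext fun i => ?_⟩
    change ∑ j, A i j * (1 / (((n : ℝ) • v') ᵥ* A) j) = b i
    rw [← hb i, Finset.mul_sum]
    refine Finset.sum_congr rfl fun j _ => ?_
    rw [hw]
    have := (hq0 j).ne'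
    field_simp
  have hmax := maxEntropyWeight_eq hwpos rfl hmem
  refine ⟨⟨rank_eq_of_vecMul fun z hz => ?_, isCompact_polytope_of_vecMul_pos hwpos,
    _, hmem, fun j => one_div_pos.2 (hwpos j)⟩, fun i j => ?_⟩
  · have h := hq z
    simp only [hz, Pi.zero_apply, zero_div] at h
    refine dotProduct_self_eq_zero.1 (le_antisymm ?_ (dotProduct_self_nonneg' z))
    simp at h
    nlinarith
  -- This uses the upper bound `w j ≤ 2 * n * (v ᵥ* A) j`; the column bound `hcol` uses the lower
  -- bound `w j ≥ n * p₀ / 2`.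
  · have hgram : ∀ z, c / (4 * n) * (z ⬝ᵥ z) ≤
        z ⬝ᵥ ((tildeMatrix A b * (tildeMatrix A b)ᵀ) *ᵥ z) := by
      intro z
      rw [dotProduct_mul_transpose_mulVec]
      calc c / (4 * n) * (z ⬝ᵥ z) = (4 * n : ℝ)⁻¹ * (c * (z ⬝ᵥ z)) := by ring
        _ ≤ (4 * n : ℝ)⁻¹ * ((n : ℝ)⁻¹ * ∑ j, ((z ᵥ* A) j / (v ᵥ* A) j) ^ 2) :=
            mul_le_mul_of_nonneg_left (hq z) (by positivity)
        _ = ∑ j, ((z ᵥ* A) j / (n * (2 * (v ᵥ* A) j))) ^ 2 := by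
            rw [Finset.mul_sum, Finset.mul_sum]
            refine Finset.sum_congr rfl fun j _ => ?_
            have := (hppos j).ne'
            field_simp
            ring
        _ ≤ ∑ j, ((z ᵥ* tildeMatrix A b) j) ^ 2 := by
            refine Finset.sum_le_sum fun j _ => ?_
            rw [vecMul_tildeMatrix, hmax, hw, div_pow, div_pow]
            have := hq0 j
            have := hhi j
            gcongr
    refine (sq_hatMatrix_le (by positivity) hgram i j).trans ?_
    have hcol : ∑ k, tildeMatrix A b k j ^ 2 ≤ m * (4 * R ^ 2 / (n ^ 2 * p₀ ^ 2)) := by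
      calc ∑ k, tildeMatrix A b k j ^ 2 ≤ ∑ _k : Fin m, 4 * R ^ 2 / (n ^ 2 * p₀ ^ 2) := by
            refine Finset.sum_le_sum fun k _ => ?_
            have h1 : tildeMatrix A b k j = A k j / (n * (v' ᵥ* A) j) := by
              rw [← hw, ← hmax]
              rfl
            have h2 : A k j ^ 2 ≤ R ^ 2 := by
              rw [← sq_abs]
              exact pow_le_pow_left₀ (abs_nonneg _) (hR k j) 2
            have h3 : p₀ / 2 ≤ (v' ᵥ* A) j := by linarith [hp j, hlo j]
            rw [h1, div_pow]
            calc A k j ^ 2 / (n * (v' ᵥ* A) j) ^ 2 ≤ R ^ 2 / (n * (p₀ / 2)) ^ 2 := by gcongr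
              _ = 4 * R ^ 2 / (n ^ 2 * p₀ ^ 2) := by
                field_simp
                ring
        _ = m * (4 * R ^ 2 / (n ^ 2 * p₀ ^ 2)) := by simp
    calc (∑ k, tildeMatrix A b k j ^ 2) / (c / (4 * n))
        ≤ m * (4 * R ^ 2 / (n ^ 2 * p₀ ^ 2)) / (c / (4 * n)) := by gcongr
      _ = 16 * m * R ^ 2 / (c * p₀ ^ 2) * (n : ℝ)⁻¹ := by
        field_simp
        ring

end deterministic

/-! ### Random columns -/

/-- The weak law of large numbers for a bounded function of independent variables; the underlying
probability space may change with the number of variables. -/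
lemma tendsto_measure_average_sub_integral {E : Type*} [MeasurableSpace E] {P : Measure E}
    [IsProbabilityMeasure P] {φ : E → ℝ} (hφ : Measurable φ) {C : ℝ} (hC : ∀ᵐ u ∂P, ‖φ u‖ ≤ C)
    {Ω : ℕ → Type*} [∀ n, MeasurableSpace (Ω n)] {μ : ∀ n, Measure (Ω n)}
    [∀ n, IsProbabilityMeasure (μ n)] {X : ∀ n, Fin n → Ω n → E} (hX : ∀ n j, Measurable (X n j))
    (hind : ∀ n, iIndepFun (X n) (μ n)) (hlaw : ∀ n j, (μ n).map (X n j) = P) {δ : ℝ}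
    (hδ : 0 < δ) :
    Tendsto (fun n => μ n {ω | δ ≤ |(n : ℝ)⁻¹ * ∑ j, φ (X n j ω) - ∫ u, φ u ∂P|}) atTop (𝓝 0) := by
  have hφ2 : MemLp φ 2 P := MemLp.of_bound hφ.aestronglyMeasurable C hC
  have hmem : ∀ n j, MemLp (φ ∘ X n j) 2 (μ n) := fun n j =>
    MemLp.comp_of_map (by rwa [hlaw n j]) (hX n j).aemeasurable
  have hmean : ∀ n j, ∫ ω, (φ ∘ X n j) ω ∂(μ n) = ∫ u, φ u ∂P := fun n j => by
    rw [← hlaw n j, integral_map (hX n j).aemeasurable hφ.aestronglyMeasurable]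
    rfl
  have hvar : ∀ n j, Var[φ ∘ X n j; μ n] = Var[φ; P] := fun n j => by
    rw [← variance_map hφ.aemeasurable (hX n j).aemeasurable, hlaw n j]
  have hbound : ∀ n : ℕ, 0 < n →
      μ n {ω | δ ≤ |(n : ℝ)⁻¹ * ∑ j, φ (X n j ω) - ∫ u, φ u ∂P|} ≤
        ENNReal.ofReal (Var[φ; P] / δ ^ 2 * (n : ℝ)⁻¹) := by
    intro n hn
    have hn' : (0 : ℝ) < n := Nat.cast_pos.2 hn
    have hsum : MemLp (∑ j, φ ∘ X n j) 2 (μ n) := memLp_finsetSum' _ fun j _ => hmem n j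
    -- Chebyshev for the sum with threshold `n * δ`; by independence its variance is `n` times that
    -- of `φ`.
    have hcheb := meas_ge_le_variance_div_sq hsum (mul_pos hn' hδ)
    rw [IndepFun.variance_sum (fun j _ => hmem n j) fun i _ j _ hij =>
      ((hind n).indepFun hij).comp hφ hφ] at hcheb
    have hint : ∫ ω, (∑ j, φ ∘ X n j) ω ∂(μ n) = n * ∫ u, φ u ∂P := by
      simp only [Finset.sum_apply]
      rw [integral_finsetSum _ fun j _ => (hmem n j).integrable (by norm_num),
        Finset.sum_congr rfl fun j _ => hmean n j]
      simp
    simp only [hvar, hint, Finset.sum_const, Finset.card_univ, Fintype.card_fin,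
      nsmul_eq_mul] at hcheb
    refine (measure_mono fun ω hω => ?_).trans (hcheb.trans_eq ?_)
    · simp only [Set.mem_ofPred_eq, Finset.sum_apply, Function.comp_apply] at hω ⊢
      have h1 : ∑ j, φ (X n j ω) - n * ∫ u, φ u ∂P =
          n * ((n : ℝ)⁻¹ * ∑ j, φ (X n j ω) - ∫ u, φ u ∂P) := by
        field_simp
      rw [h1, abs_mul, abs_of_pos hn']
      exact mul_le_mul_of_nonneg_left hω hn'.le
    · congr 1
      field_simp
  have hlim : Tendsto (fun n : ℕ => ENNReal.ofReal (Var[φ; P] / δ ^ 2 * (n : ℝ)⁻¹)) atTop (𝓝 0) := by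
    have h := (tendsto_inv_atTop_nhds_zero_nat (𝕜 := ℝ)).const_mul (Var[φ; P] / δ ^ 2)
    rw [mul_zero] at h
    simpa using ENNReal.tendsto_ofReal h
  exact tendsto_of_tendsto_of_tendsto_of_le_of_le' tendsto_const_nhds hlim
    (Eventually.of_forall fun _ => zero_le)
    ((eventually_gt_atTop 0).mono hbound)

section columnLaw

variable {m : ℕ}

lemma sq_dotProduct_div (z u : Fin m → ℝ) (t : ℝ) :
    (z ⬝ᵥ u / t) ^ 2 = ∑ i, ∑ k, z i * z k * (u i * u k / t ^ 2) := by
  rw [div_pow, sq (z ⬝ᵥ u), dotProduct, Finset.sum_mul_sum, Finset.sum_div]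
  refine Finset.sum_congr rfl fun i _ => ?_
  rw [Finset.sum_div]
  exact Finset.sum_congr rfl fun k _ => by ring

/-- The form is `∫ (⟨z, u⟩ / ⟨v, u⟩) ^ 2 dP`. If it vanishes, `⟨z, ·⟩` is zero almost everywhere,
hence on the support by closedness, so `z = 0`. Compactness of the sphere and homogeneity give the
constant. -/
lemma exists_quadratic_lower_bound {P : Measure (Fin m → ℝ)} [IsProbabilityMeasure P] (hm : 0 < m)
    (hP : ∀ z : Fin m → ℝ, z ≠ 0 → ∃ u ∈ P.support, z ⬝ᵥ u ≠ 0) {v : Fin m → ℝ}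
    (hv : ∀ u ∈ P.support, 0 < v ⬝ᵥ u)
    (hint : ∀ i k, Integrable (fun u : Fin m → ℝ => u i * u k / (v ⬝ᵥ u) ^ 2) P) :
    ∃ c > 0, ∀ z : Fin m → ℝ,
      c * ‖z‖ ^ 2 ≤ ∑ i, ∑ k, z i * z k * ∫ u, u i * u k / (v ⬝ᵥ u) ^ 2 ∂P := by
  have : Nonempty (Fin m) := ⟨⟨0, hm⟩⟩
  set q : (Fin m → ℝ) → ℝ := fun z => ∑ i, ∑ k, z i * z k * ∫ u, u i * u k / (v ⬝ᵥ u) ^ 2 ∂P with hq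
  have hqint : ∀ z : Fin m → ℝ, Integrable (fun u => (z ⬝ᵥ u / v ⬝ᵥ u) ^ 2) P := fun z => by
    simp only [sq_dotProduct_div]
    exact integrable_finsetSum _ fun i _ => integrable_finsetSum _ fun k _ =>
      (hint i k).const_mul _
  have hqeq : ∀ z, q z = ∫ u, (z ⬝ᵥ u / v ⬝ᵥ u) ^ 2 ∂P := fun z => by
    simp only [hq, sq_dotProduct_div]
    rw [integral_finsetSum _ fun i _ => integrable_finsetSum _ fun k _ => (hint i k).const_mul _]
    refine Finset.sum_congr rfl fun i _ => ?_
    rw [integral_finsetSum _ fun k _ => (hint i k).const_mul _]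
    exact Finset.sum_congr rfl fun k _ => (integral_const_mul _ _).symm
  have hqpos : ∀ z, z ≠ 0 → 0 < q z := by
    intro z hz
    rw [hqeq]
    refine (integral_nonneg fun u => sq_nonneg _).lt_of_ne fun h0 => ?_
    have hae := (integral_eq_zero_iff_of_nonneg (fun u => sq_nonneg _) (hqint z)).1 h0.symm
    have hsub : P.support ⊆ {u | z ⬝ᵥ u = 0} := by
      refine Measure.support_subset_of_isClosed
        (isClosed_eq (continuous_const.dotProduct continuous_id) continuous_const) ?_
      filter_upwards [hae, Measure.support_mem_ae (μ := P)] with u hu hus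
      simpa [(hv u hus).ne'] using hu
    obtain ⟨u, hu, hzu⟩ := hP z hz
    exact hzu (hsub hu)
  have hqcont : Continuous q := by fun_prop
  obtain ⟨z₀, hz₀, hmin⟩ := (isCompact_sphere (0 : Fin m → ℝ) 1).exists_isMinOn
    ⟨fun _ => 1, by simp⟩ hqcont.continuousOn
  have hz₀' : z₀ ≠ 0 := by
    rintro rfl
    simp at hz₀
  refine ⟨q z₀, hqpos z₀ hz₀', fun z => ?_⟩
  rcases eq_or_ne z 0 with rfl | hz
  · simp
  have hnz : ‖z‖ ≠ 0 := norm_ne_zero_iff.2 hz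
  have h1 : q z₀ ≤ q (‖z‖⁻¹ • z) := hmin (by simp [norm_smul, hnz])
  have h2 : q z = ‖z‖ ^ 2 * q (‖z‖⁻¹ • z) := by
    simp only [hq, Finset.mul_sum, Pi.smul_apply, smul_eq_mul]
    refine Finset.sum_congr rfl fun i _ => Finset.sum_congr rfl fun k _ => ?_
    field_simp
  calc q z₀ * ‖z‖ ^ 2 ≤ q (‖z‖⁻¹ • z) * ‖z‖ ^ 2 := mul_le_mul_of_nonneg_right h1 (sq_nonneg _)
    _ = q z := by rw [h2, mul_comm]

/-- Entrywise perturbations of a quadratic form. -/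
lemma quadratic_sub_le {S T : Fin m → Fin m → ℝ} {δ : ℝ} (hST : ∀ i k, |T i k - S i k| ≤ δ)
    (z : Fin m → ℝ) : ∑ i, ∑ k, z i * z k * S i k - δ * m ^ 2 * ‖z‖ ^ 2 ≤
      ∑ i, ∑ k, z i * z k * T i k := by
  have h : ∑ i, ∑ k, (z i * z k * S i k - z i * z k * T i k) ≤
      ∑ _i : Fin m, ∑ _k : Fin m, δ * ‖z‖ ^ 2 := by
    refine Finset.sum_le_sum fun i _ => Finset.sum_le_sum fun k _ => ?_
    calc z i * z k * S i k - z i * z k * T i k = -(z i * z k * (T i k - S i k)) := by ring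
      _ ≤ |z i * z k * (T i k - S i k)| := neg_le_abs _
      _ = |z i| * |z k| * |T i k - S i k| := by rw [abs_mul, abs_mul]
      _ ≤ ‖z‖ * ‖z‖ * δ := by
        have h1 := norm_le_pi_norm z i
        have h2 := norm_le_pi_norm z k
        rw [Real.norm_eq_abs] at h1 h2
        have h3 := hST i k
        gcongr
      _ = δ * ‖z‖ ^ 2 := by ring
  simp only [Finset.sum_sub_distrib, Finset.sum_const, Finset.card_univ, Fintype.card_fin,
    nsmul_eq_mul] at h
  linarith

/-- Outside finitely many events controlled by the law of large numbers, and a null set, the columns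
satisfy the hypotheses of `isNondegenerate_and_sq_hatMatrix_le` with constants independent of `n`.
-/
theorem tendsto_measure_not_isNondegenerate_and_maxNorm_le {P : Measure (Fin m → ℝ)}
    (hP : IsAdmissibleColumnLaw P) {b : Fin m → ℝ} (hb : b ∈ goodRightHandSides P)
    {Ω : ℕ → Type*} [∀ n, MeasurableSpace (Ω n)] {μ : ∀ n, Measure (Ω n)}
    [∀ n, IsProbabilityMeasure (μ n)] {X : ∀ n, Fin n → Ω n → Fin m → ℝ}
    (hX : ∀ n j, Measurable (X n j)) (hind : ∀ n, iIndepFun (X n) (μ n))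
    (hlaw : ∀ n j, (μ n).map (X n j) = P) {ε : ℝ} (hε : 0 < ε) :
    Tendsto (fun n => μ n {ω | ¬ (IsNondegenerate (Matrix.of fun i j => X n j ω i) b ∧
      maxNorm (hatMatrix (Matrix.of fun i j => X n j ω i) b) ≤ ε)}) atTop (𝓝 0) := by
  have := hP.isProbabilityMeasure
  obtain ⟨v, hv, hbv⟩ := hb
  set U := P.support with hU
  have hUae : ∀ᵐ u ∂P, u ∈ U := Measure.support_mem_ae
  have hUne : U.Nonempty := Measure.nonempty_support (IsProbabilityMeasure.ne_zero P)
  have hcv : Continuous fun u : Fin m → ℝ => v ⬝ᵥ u := continuous_const.dotProduct continuous_id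
  obtain ⟨u₀, hu₀, hu₀min⟩ := hP.isCompact_support.exists_isMinOn hUne hcv.continuousOn
  set p₀ := v ⬝ᵥ u₀ with hp₀def
  have hp₀ : 0 < p₀ := hv u₀ hu₀
  have hm : 0 < m := by
    by_contra h0
    obtain rfl : m = 0 := by omega
    simp [dotProduct] at hp₀def
    exact hp₀.ne' hp₀def
  have : Nonempty (Fin m) := ⟨⟨0, hm⟩⟩
  have hm' : (0 : ℝ) < m := Nat.cast_pos.2 hm
  obtain ⟨R, hR⟩ := hP.isCompact_support.exists_bound_of_continuousOn continuousOn_id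
  have hR0 : 0 ≤ R := (norm_nonneg _).trans (hR u₀ hu₀)
  have hφm : ∀ i, Measurable fun u : Fin m → ℝ => u i / v ⬝ᵥ u := fun i =>
    (measurable_pi_apply i).div hcv.measurable
  have hψm : ∀ i k, Measurable fun u : Fin m → ℝ => u i * u k / (v ⬝ᵥ u) ^ 2 := fun i k =>
    ((measurable_pi_apply i).mul (measurable_pi_apply k)).div (hcv.measurable.pow_const 2)
  have hφb : ∀ i, ∃ C, ∀ᵐ u ∂P, ‖u i / v ⬝ᵥ u‖ ≤ C := fun i => by
    obtain ⟨C, hC⟩ := hP.isCompact_support.exists_bound_of_continuousOn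
      (f := fun u : Fin m → ℝ => u i / v ⬝ᵥ u)
      ((continuous_apply i).continuousOn.div hcv.continuousOn fun u hu => (hv u hu).ne')
    exact ⟨C, hUae.mono hC⟩
  have hψb : ∀ i k, ∃ C, ∀ᵐ u ∂P, ‖u i * u k / (v ⬝ᵥ u) ^ 2‖ ≤ C := fun i k => by
    obtain ⟨C, hC⟩ := hP.isCompact_support.exists_bound_of_continuousOn
      (f := fun u : Fin m → ℝ => u i * u k / (v ⬝ᵥ u) ^ 2)
      (((continuous_apply i).mul (continuous_apply k)).continuousOn.div
        (hcv.pow 2).continuousOn fun u hu => pow_ne_zero 2 (hv u hu).ne')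
    exact ⟨C, hUae.mono hC⟩
  choose Cφ hCφ using hφb
  choose Cψ hCψ using hψb
  obtain ⟨c, hc, hquad⟩ := exists_quadratic_lower_bound hm hP.not_hyperplane hv fun i k =>
    Integrable.of_bound (hψm i k).aestronglyMeasurable (Cψ i k) (hCψ i k)
  -- `r` keeps `|⟨h, u⟩| ≤ p₀ / 2` on the support. Half of `c` is spent on the sampling error `δ₂ *
  -- m ^ 2`, and the `m` in `c'` converts the sup norm to the dot product. The `m` coordinate errors
  -- `δ₁` add up to `c' * r / 6`.
  set r := p₀ / (2 * m * (R + 1)) with hrdef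
  have hr : 0 < r := by positivity
  set c' := c / (2 * m) with hc'def
  have hc' : 0 < c' := by positivity
  set δ₁ := c' * r / 6 / m with hδ₁def
  have hδ₁ : 0 < δ₁ := by positivity
  set δ₂ := c / (2 * m ^ 2) with hδ₂def
  have hδ₂ : 0 < δ₂ := by positivity
  have hlim₁ := fun i =>
    tendsto_measure_average_sub_integral (hφm i) (hCφ i) hX hind hlaw hδ₁
  have hlim₂ := fun i k =>
    tendsto_measure_average_sub_integral (hψm i k) (hCψ i k) hX hind hlaw hδ₂
  have hlim := (tendsto_finsetSum Finset.univ fun i _ => hlim₁ i).add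
    (tendsto_finsetSum Finset.univ fun i _ => tendsto_finsetSum Finset.univ fun k _ => hlim₂ i k)
  simp only [Finset.sum_const_zero, add_zero] at hlim
  refine tendsto_of_tendsto_of_tendsto_of_le_of_le' tendsto_const_nhds hlim
    (Eventually.of_forall fun _ => zero_le) ?_
  have hsmallε : ∀ᶠ n : ℕ in atTop, 16 * m * R ^ 2 / (c' * p₀ ^ 2) * (n : ℝ)⁻¹ < ε ^ 2 := by
    have h := (tendsto_inv_atTop_nhds_zero_nat (𝕜 := ℝ)).const_mul
      (16 * m * R ^ 2 / (c' * p₀ ^ 2))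
    rw [mul_zero] at h
    exact h.eventually_lt_const (by positivity)
  filter_upwards [hsmallε, eventually_gt_atTop 0] with n hnε hn
  have hcols : μ n {ω | ∀ j, X n j ω ∈ U}ᶜ = 0 := by
    have : ∀ᵐ ω ∂(μ n), ∀ j, X n j ω ∈ U := ae_all_iff.2 fun j =>
      ae_of_ae_map (hX n j).aemeasurable (by rw [hlaw n j]; exact hUae)
    exact this
  have hsub : {ω | ¬ (IsNondegenerate (Matrix.of fun i j => X n j ω i) b ∧
      maxNorm (hatMatrix (Matrix.of fun i j => X n j ω i) b) ≤ ε)} ⊆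
      {ω | ∀ j, X n j ω ∈ U}ᶜ ∪
      ((⋃ i, {ω | δ₁ ≤ |(n : ℝ)⁻¹ * ∑ j, X n j ω i / v ⬝ᵥ X n j ω - ∫ u, u i / v ⬝ᵥ u ∂P|}) ∪
      ⋃ i, ⋃ k, {ω | δ₂ ≤ |(n : ℝ)⁻¹ * ∑ j, X n j ω i * X n j ω k / (v ⬝ᵥ X n j ω) ^ 2 -
        ∫ u, u i * u k / (v ⬝ᵥ u) ^ 2 ∂P|}) := by
    intro ω hω
    by_contra hgood
    simp only [Set.mem_union, Set.mem_compl_iff, Set.mem_iUnion, Set.mem_ofPred_eq, not_or,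
      not_not, not_exists, not_le] at hgood
    obtain ⟨hcol, h1, h2⟩ := hgood
    refine hω ?_
    set A : Matrix (Fin m) (Fin n) ℝ := Matrix.of fun i j => X n j ω i with hA
    have hvec : ∀ (z : Fin m → ℝ) j, (z ᵥ* A) j = z ⬝ᵥ X n j ω := fun z j => rfl
    have hlow : ∀ j, p₀ ≤ (v ᵥ* A) j := fun j => hu₀min (hcol j)
    have hAR : ∀ i j, |A i j| ≤ R := fun i j => (norm_le_pi_norm (X n j ω) i).trans (hR _ (hcol j))
    have hsmall : ∀ h : Fin m → ℝ, ‖h‖ ≤ r → ∀ j, |(h ᵥ* A) j| ≤ (v ᵥ* A) j / 2 := by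
      intro h hh j
      have hsum : ∑ i, |X n j ω i| ≤ m * R := by
        calc ∑ i, |X n j ω i| ≤ ∑ _i : Fin m, R := Finset.sum_le_sum fun i _ => hAR i j
          _ = m * R := by simp
      calc |(h ᵥ* A) j| ≤ ‖h‖ * ∑ i, |X n j ω i| := abs_dotProduct_le h _
        _ ≤ r * (m * (R + 1)) := by
          refine mul_le_mul hh (hsum.trans ?_) (Finset.sum_nonneg fun _ _ => abs_nonneg _) hr.le
          exact mul_le_mul_of_nonneg_left (by linarith) hm'.le
        _ = p₀ / 2 := by
          rw [hrdef]
          field_simp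
        _ ≤ (v ᵥ* A) j / 2 := by linarith [hlow j]
    have hq : ∀ z, c' * (z ⬝ᵥ z) ≤ (n : ℝ)⁻¹ * ∑ j, ((z ᵥ* A) j / (v ᵥ* A) j) ^ 2 := by
      intro z
      have hexp : (n : ℝ)⁻¹ * ∑ j, ((z ᵥ* A) j / (v ᵥ* A) j) ^ 2 = ∑ i, ∑ k, z i * z k *
          ((n : ℝ)⁻¹ * ∑ j, X n j ω i * X n j ω k / (v ⬝ᵥ X n j ω) ^ 2) := by
        simp only [hvec, sq_dotProduct_div, Finset.mul_sum]
        rw [Finset.sum_comm]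
        refine Finset.sum_congr rfl fun i _ => ?_
        rw [Finset.sum_comm]
        exact Finset.sum_congr rfl fun k _ => Finset.sum_congr rfl fun j _ => by ring
      have hpert := quadratic_sub_le (fun i k => (h2 i k).le) z
      rw [← hexp] at hpert
      have hδm : δ₂ * m ^ 2 = c / 2 := by
        rw [hδ₂def]
        field_simp
      rw [hδm] at hpert
      have h3 := hquad z
      have h4 : c' * (z ⬝ᵥ z) ≤ c / 2 * ‖z‖ ^ 2 := by
        calc c' * (z ⬝ᵥ z) ≤ c' * (m * ‖z‖ ^ 2) :=
              mul_le_mul_of_nonneg_left (dotProduct_self_le_sq_norm z) hc'.le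
          _ = c / 2 * ‖z‖ ^ 2 := by
              rw [hc'def]
              field_simp
      linarith
    have he : ∑ i, |(n : ℝ)⁻¹ * ∑ j, A i j / (v ᵥ* A) j - b i| < c' * r / 6 := by
      calc ∑ i, |(n : ℝ)⁻¹ * ∑ j, A i j / (v ᵥ* A) j - b i| < ∑ _i : Fin m, δ₁ := by
            refine Finset.sum_lt_sum_of_nonempty Finset.univ_nonempty fun i _ => ?_
            rw [hbv i]
            exact h1 i
        _ = c' * r / 6 := by
            rw [hδ₁def]
            simp
            field_simp
    obtain ⟨hnd, hhat⟩ :=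
      isNondegenerate_and_sq_hatMatrix_le hn hp₀ hlow hAR hr hsmall hc' hq he
    exact ⟨hnd, maxNorm_le hε.le fun i j =>
      abs_le_of_sq_le_sq ((hhat i j).trans hnε.le) hε.le⟩
  refine (measure_mono hsub).trans ((measure_union_le _ _).trans ?_)
  rw [hcols, zero_add]
  refine (measure_union_le _ _).trans (add_le_add (measure_iUnion_fintype_le _ _) ?_)
  exact (measure_iUnion_fintype_le _ _).trans
    (Finset.sum_le_sum fun i _ => measure_iUnion_fintype_le _ _)

end columnLaw

theorem proposition3p1 (m : ℕ) :
    -- part (1)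
    (∀ (A : ∀ n, Matrix (Fin m) (Fin n) ℝ) (b : ℕ → Fin m → ℝ),
      (∀ n, m < n → IsNondegenerate (A n) (b n)) →
      Tendsto (fun n => maxNorm (hatMatrix (A n) (b n))) atTop (𝓝 0) →
      PropertyA (fun n => hatMatrix (A n) (b n))) ∧
    -- part (2)
    (∀ (A : ∀ n, Matrix (Fin m) (Fin n) ℝ) (b : ℕ → Fin m → ℝ),
      (∀ n, m < n → IsNondegenerate (A n) (b n)) →
      (∀ K n₀ : ℕ, m < n₀ →
        (∀ n, n₀ ≤ n → ∀ j, K ≤ columnMultiplicity (A n) j) →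
        PropertyAFor (fun n => hatMatrix (A n) (b n)) K n₀) ∧
      ((∀ R : ℕ, ∀ᶠ n in atTop, ∀ j, R ≤ columnMultiplicity (A n) j) →
        Tendsto (fun n => maxNorm (hatMatrix (A n) (b n))) atTop (𝓝 0))) ∧
    -- part (3)
    (∀ (P : Measure (Fin m → ℝ)), IsAdmissibleColumnLaw P →
      ∀ b ∈ goodRightHandSides P,
      ∀ (Ω : ℕ → Type*) [∀ n, MeasurableSpace (Ω n)] (μ : ∀ n, Measure (Ω n))
        [∀ n, IsProbabilityMeasure (μ n)] (X : ∀ n, Fin n → Ω n → Fin m → ℝ),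
      (∀ n j, Measurable (X n j)) →
      (∀ n, iIndepFun (X n) (μ n)) →
      (∀ n j, (μ n).map (X n j) = P) →
      ∀ ε : ℝ, 0 < ε →
        Tendsto (fun n => μ n {ω | ¬ (IsNondegenerate (Matrix.of fun i j => X n j ω i) b ∧
          maxNorm (hatMatrix (Matrix.of fun i j => X n j ω i) b) ≤ ε)}) atTop (𝓝 0)) :=
  ⟨fun _ _ hnd h => propertyA_of_tendsto_maxNorm hnd h,
    fun _ _ hnd => ⟨fun _ _ hn₀ h => propertyAFor_of_le_columnMultiplicity hnd hn₀ h,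
      fun h => tendsto_maxNorm_of_columnMultiplicity hnd h⟩,
    fun _ hP _ hb _ _ _ _ _ hX hind hlaw _ hε =>
      tendsto_measure_not_isNondegenerate_and_maxNorm_le hP hb hX hind hlaw hε⟩
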